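/- All $C^*$-algebras are unital and complex, all $*$-homomorphisms are unital, and $\hat\otimes$ denotes the minimal (spatial) tensor product. A *$C^*$-compact quantum group* is a unital $C^*$-algebra $A$ with a $*$-homomorphism $\Delta : A \to A \hat\otimes A$ that is coassociative, $(\Delta \hat\otimes \mathrm{id})\Delta = (\mathrm{id} \hat\otimes \Delta)\Delta$ as maps $A \to A\hat\otimes A\hat\otimes A$, and such that the linear spans of $\Delta(A)(A \otimes 1)$ and $\Delta(A)(1 \otimes A)$ are dense in $A \hat\otimes A$. A (unital) *$\sigma$-$C^*$-algebra* is a topological $*$-algebra $A$ isomorphic to an inverse limit $\varprojlim_{n\in\mathbb N} A_n$, formed in topological $*$-algebras, of $C^*$-algebras with surjective connecting maps; one puts $A \hat\otimes A = \varprojlim_n A_n \hat\otimes A_n$ and $A \hat\otimes A \hat\otimes A = \varprojlim_n A_n \hat\otimes A_n \hat\otimes A_n$. A *$\sigma$-$C^*$-quantum group* is a $\sigma$-$C^*$-algebra $A$ with a continuous $*$-homomorphism $\Delta : A \to A \hat\otimes A$ that is coassociative and such that the linear spans of $\Delta(A)(A \otimes 1)$ and $\Delta(A)(1 \otimes A)$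 are dense in $A \hat\otimes A$. (i) Every $C^*$-compact quantum group $(A, \Delta)$ is a $\sigma$-$C^*$-quantum group (with $A$ viewed as the inverse limit of the constant system $A \leftarrow A \leftarrow \cdots$). (ii) Let $(A_n, \Delta_n)_{n \in \mathbb N}$ be $C^*$-compact quantum groups with surjective $*$-homomorphisms $\theta_n : A_{n+1} \to A_n$ such that $(\theta_n \hat\otimes \theta_n)\Delta_{n+1} = \Delta_n \theta_n$ for all $n$. Then $(A, \Delta) = (\varprojlim_n A_n, \varprojlim_n \Delta_n)$ is a $\sigma$-$C^*$-quantum group; that is, $\Delta : A \to A \hat\otimes A$ is a continuous coassociative $*$-homomorphism and the linear spans of $\Delta(A)(A \otimes 1)$ and $\Delta(A)(1 \otimes A)$ are dense in $A \hat\otimes A$. -/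

import Mathlib

open scoped TensorProduct InnerProductSpace

universe u v

noncomputable section

namespace SigmaCStar

/-! ### C⋆-seminorms and their Hausdorff completions -/

/-- A C⋆-seminorm on a unital complex ⋆-algebra. -/
structure CStarSeminorm (X : Type u) [Ring X] [StarRing X] [Algebra ℂ X] extends
    Seminorm ℂ X where
  mul_le' : ∀ x y, toFun (x * y) ≤ toFun x * toFun y
  star_mul_self' : ∀ x, toFun (star x * x) = toFun x * toFun x

namespace CStarSeminorm

variable {X : Type u} [Ring X] [StarRing X] [Algebra ℂ X]

instance : CoeFun (CStarSeminorm X) (fun _ => X → ℝ) := ⟨fun p => p.toSeminorm⟩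

theorem nonneg (p : CStarSeminorm X) (x : X) : 0 ≤ p x := apply_nonneg p.toSeminorm x

theorem mul_le (p : CStarSeminorm X) (x y : X) : p (x * y) ≤ p x * p y := p.mul_le' x y

theorem star_mul_self (p : CStarSeminorm X) (x : X) : p (star x * x) = p x * p x :=
  p.star_mul_self' x

theorem le_star (p : CStarSeminorm X) (x : X) : p x ≤ p (star x) := by
  by_cases h : p x = 0
  · rw [h]; exact p.nonneg _
  · have h1 : 0 < p x := lt_of_le_of_ne (p.nonneg x) (Ne.symm h)
    have h2 : p x * p x ≤ p (star x) * p x := by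
      rw [← p.star_mul_self]; exact p.mul_le _ _
    exact le_of_mul_le_mul_right h2 h1

theorem star_eq (p : CStarSeminorm X) (x : X) : p (star x) = p x :=
  le_antisymm (by simpa using p.le_star (star x)) (p.le_star x)

/-- The supremum of a pointwise bounded family of C⋆-seminorms. -/
def iSup {ι : Type v} [Nonempty ι] (p : ι → CStarSeminorm X)
    (hb : ∀ x, BddAbove (Set.range fun i => p i x)) : CStarSeminorm X where
  toFun x := ⨆ i, p i x
  map_zero' := by simp
  add_le' x y := ciSup_le fun i => (map_add_le_add (p i).toSeminorm x y).trans
    (add_le_add (le_ciSup (hb x) i) (le_ciSup (hb y) i))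
  neg' x := by simp
  smul' a x := by
    simp only [map_smul_eq_mul]
    rw [Real.mul_iSup_of_nonneg (norm_nonneg a)]
  mul_le' x y := ciSup_le fun i => ((p i).mul_le x y).trans
    (mul_le_mul (le_ciSup (hb x) i) (le_ciSup (hb y) i) ((p i).nonneg y)
      (((p i).nonneg x).trans (le_ciSup (hb x) i)))
  star_mul_self' x := by
    have hx : ∀ i, p i x ≤ ⨆ i, p i x := fun i => le_ciSup (hb x) i
    have h0 : 0 ≤ ⨆ i, p i x := Real.iSup_nonneg fun i => (p i).nonneg x
    apply le_antisymm
    · exact ciSup_le fun i => by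
        rw [(p i).star_mul_self]
        exact mul_le_mul (hx i) (hx i) ((p i).nonneg x) h0
    · have hs : (⨆ i, p i x) ≤ Real.sqrt (⨆ i, p i (star x * x)) := ciSup_le fun i => by
        apply Real.le_sqrt_of_sq_le
        rw [sq, ← (p i).star_mul_self]
        exact le_ciSup (hb (star x * x)) i
      have h1 : 0 ≤ ⨆ i, p i (star x * x) := Real.iSup_nonneg fun i => (p i).nonneg _
      calc _ ≤ Real.sqrt (⨆ i, p i (star x * x)) * Real.sqrt (⨆ i, p i (star x * x)) :=
            mul_le_mul hs hs h0 (Real.sqrt_nonneg _)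
        _ = _ := Real.mul_self_sqrt h1

theorem le_iSup {ι : Type v} [Nonempty ι] (p : ι → CStarSeminorm X)
    (hb : ∀ x, BddAbove (Set.range fun i => p i x)) (i : ι) (x : X) : p i x ≤ iSup p hb x :=
  le_ciSup (hb x) i

theorem iSup_le {ι : Type v} [Nonempty ι] (p : ι → CStarSeminorm X)
    (hb : ∀ x, BddAbove (Set.range fun i => p i x)) {x : X} {C : ℝ} (h : ∀ i, p i x ≤ C) :
    iSup p hb x ≤ C :=
  ciSup_le h

/-- The ⋆-algebra `X` regarded as a seminormed algebra with the seminorm `p`. -/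
def Carrier (_p : CStarSeminorm X) : Type u := X

variable (p : CStarSeminorm X)

instance : Ring p.Carrier := inferInstanceAs (Ring X)
instance : StarRing p.Carrier := inferInstanceAs (StarRing X)
instance : Algebra ℂ p.Carrier := inferInstanceAs (Algebra ℂ X)
instance [StarModule ℂ X] : StarModule ℂ p.Carrier := inferInstanceAs (StarModule ℂ X)

instance : SeminormedRing p.Carrier where
  __ := (inferInstance : Ring p.Carrier)
  __ := (AddGroupSeminorm.toSeminormedAddCommGroup
    (E := p.Carrier) p.toSeminorm.toAddGroupSeminorm)
  norm_mul_le := p.mul_le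

theorem norm_carrier (x : p.Carrier) : ‖x‖ = p x := rfl

instance : NormedAlgebra ℂ p.Carrier where
  __ := (inferInstance : Algebra ℂ p.Carrier)
  norm_smul_le a x := (map_smul_eq_mul p.toSeminorm a x).le

instance : NormedStarGroup p.Carrier where
  norm_star_le x := (p.star_eq x).le

/-- The Hausdorff completion of `X` with respect to the C⋆-seminorm `p`. -/
def Completion : Type u := UniformSpace.Completion p.Carrier

instance : NormedRing p.Completion := inferInstanceAs (NormedRing (UniformSpace.Completion p.Carrier))
instance : CompleteSpace p.Completion :=
  inferInstanceAs (CompleteSpace (UniformSpace.Completion p.Carrier))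
instance : Algebra ℂ p.Completion :=
  inferInstanceAs (Algebra ℂ (UniformSpace.Completion p.Carrier))

instance : NormedAlgebra ℂ p.Completion where
  norm_smul_le :=
    norm_smul_le (α := ℂ) (β := UniformSpace.Completion p.Carrier)

/-- The canonical map into the completion. -/
def toCompl (x : X) : p.Completion := ((show p.Carrier from x : p.Carrier) : UniformSpace.Completion p.Carrier)

theorem denseRange_toCompl : DenseRange p.toCompl := UniformSpace.Completion.denseRange_coe (α := p.Carrier)

theorem norm_toCompl (x : X) : ‖p.toCompl x‖ = p x := UniformSpace.Completion.norm_coe (E := p.Carrier) x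

theorem toCompl_add (x y : X) : p.toCompl (x + y) = p.toCompl x + p.toCompl y :=
  UniformSpace.Completion.coe_add (α := p.Carrier) x y

theorem toCompl_mul (x y : X) : p.toCompl (x * y) = p.toCompl x * p.toCompl y :=
  UniformSpace.Completion.coe_mul (α := p.Carrier) x y

theorem toCompl_one : p.toCompl 1 = 1 := UniformSpace.Completion.coe_one p.Carrier

theorem toCompl_algebraMap (r : ℂ) : p.toCompl (algebraMap ℂ X r) = algebraMap ℂ p.Completion r := rfl

instance : Star p.Completion :=
  ⟨UniformSpace.Completion.map (star : p.Carrier → p.Carrier)⟩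

theorem uniformContinuous_star_carrier : UniformContinuous (star : p.Carrier → p.Carrier) :=
  (star_isometry (E := p.Carrier)).uniformContinuous

theorem toCompl_star (x : X) : p.toCompl (star x) = star (p.toCompl x) :=
  (UniformSpace.Completion.map_coe p.uniformContinuous_star_carrier x).symm

theorem continuous_star_completion : Continuous (star : p.Completion → p.Completion) :=
  UniformSpace.Completion.continuous_map

instance : StarRing p.Completion where
  star_involutive x := by
    refine p.denseRange_toCompl.induction_on x (isClosed_eq ?_ ?_) fun x => ?_
    · exact p.continuous_star_completion.comp p.continuous_star_completion
    · exact continuous_id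
    · rw [← toCompl_star, ← toCompl_star, star_star]
  star_mul x y := by
    refine p.denseRange_toCompl.induction_on₂ (isClosed_eq ?_ ?_) (fun x y => ?_) x y
    · exact p.continuous_star_completion.comp (continuous_fst.mul continuous_snd)
    · exact (p.continuous_star_completion.comp continuous_snd).mul
        (p.continuous_star_completion.comp continuous_fst)
    · rw [← toCompl_mul, ← toCompl_star, ← toCompl_star, ← toCompl_star, star_mul, toCompl_mul]
  star_add x y := by
    refine p.denseRange_toCompl.induction_on₂ (isClosed_eq ?_ ?_) (fun x y => ?_) x y
    · exact p.continuous_star_completion.comp (continuous_fst.add continuous_snd)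
    · exact (p.continuous_star_completion.comp continuous_fst).add
        (p.continuous_star_completion.comp continuous_snd)
    · rw [← toCompl_add, ← toCompl_star, ← toCompl_star, ← toCompl_star, star_add, toCompl_add]

instance : CStarRing p.Completion where
  norm_mul_self_le x := by
    refine p.denseRange_toCompl.induction_on x (isClosed_le ?_ ?_) fun x => ?_
    · exact continuous_norm.mul continuous_norm
    · exact (p.continuous_star_completion.mul continuous_id).norm
    · rw [← toCompl_star, ← toCompl_mul, norm_toCompl, norm_toCompl, p.star_mul_self]

instance [StarModule ℂ X] : StarModule ℂ p.Completion where
  star_smul r x := by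
    refine p.denseRange_toCompl.induction_on x (isClosed_eq ?_ ?_) fun x => ?_
    · exact p.continuous_star_completion.comp (continuous_const_smul r)
    · exact (continuous_const_smul (star r)).comp p.continuous_star_completion
    · rw [Algebra.smul_def, ← toCompl_algebraMap, ← toCompl_mul, ← toCompl_star, ← Algebra.smul_def, star_smul,
        Algebra.smul_def, toCompl_mul, toCompl_algebraMap, ← Algebra.smul_def, toCompl_star]

instance [StarModule ℂ X] : CStarAlgebra p.Completion where

/-- The canonical ⋆-homomorphism into the completion. -/
def of : X →⋆ₐ[ℂ] p.Completion where
  toFun := p.toCompl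
  map_one' := p.toCompl_one
  map_mul' := p.toCompl_mul
  map_zero' := UniformSpace.Completion.coe_zero (α := p.Carrier)
  map_add' := p.toCompl_add
  commutes' := p.toCompl_algebraMap
  map_star' := p.toCompl_star

theorem norm_of (x : X) : ‖p.of x‖ = p x := p.norm_toCompl x

theorem denseRange_of : DenseRange p.of := p.denseRange_toCompl

variable {D : Type v} [CStarAlgebra D]

theorem uniformContinuous_lift (f : X →⋆ₐ[ℂ] D) (hf : ∀ x, ‖f x‖ ≤ p x) :
    UniformContinuous (fun x : p.Carrier => f x) :=
  (AddMonoidHomClass.uniformContinuous_of_bound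
    (show p.Carrier →+ D from (f : X →+ D)) 1 fun x => by
      rw [one_mul]; exact hf x)

/-- A ⋆-homomorphism dominated by `p` extends to the completion. -/
def lift (f : X →⋆ₐ[ℂ] D) (hf : ∀ x, ‖f x‖ ≤ p x) : p.Completion →⋆ₐ[ℂ] D :=
  have hc : Continuous (UniformSpace.Completion.extension (fun x : p.Carrier => f x)) :=
    UniformSpace.Completion.continuous_extension
  have hm : ∀ x, UniformSpace.Completion.extension (fun x : p.Carrier => f x) (p.toCompl x) = f x :=
    fun x => UniformSpace.Completion.extension_coe (p.uniformContinuous_lift f hf) x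
  { toFun := UniformSpace.Completion.extension (fun x : p.Carrier => f x)
    map_one' := by rw [← toCompl_one, hm, map_one]
    map_mul' := fun x y => by
      refine p.denseRange_toCompl.induction_on₂ (isClosed_eq ?_ ?_) (fun x y => ?_) x y
      · exact hc.comp (continuous_fst.mul continuous_snd)
      · exact (hc.comp continuous_fst).mul (hc.comp continuous_snd)
      · rw [← toCompl_mul, hm, hm, hm, map_mul]
    map_zero' := by
      have : p.toCompl 0 = 0 := map_zero p.of
      rw [← this, hm, map_zero]
    map_add' := fun x y => by
      refine p.denseRange_toCompl.induction_on₂ (isClosed_eq ?_ ?_) (fun x y => ?_) x y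
      · exact hc.comp (continuous_fst.add continuous_snd)
      · exact (hc.comp continuous_fst).add (hc.comp continuous_snd)
      · rw [← toCompl_add, hm, hm, hm, map_add]
    commutes' := fun r => by rw [← toCompl_algebraMap, hm, AlgHomClass.commutes]
    map_star' := fun x => by
      refine p.denseRange_toCompl.induction_on x (isClosed_eq ?_ ?_) fun x => ?_
      · exact hc.comp p.continuous_star_completion
      · exact hc.star
      · rw [← toCompl_star, hm, hm, map_star] }

theorem lift_of (f : X →⋆ₐ[ℂ] D) (hf : ∀ x, ‖f x‖ ≤ p x) (x : X) : p.lift f hf (p.of x) = f x :=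
  UniformSpace.Completion.extension_coe (p.uniformContinuous_lift f hf) x

end CStarSeminorm

/-! ### Representations and the spatial tensor product -/

/-- A unital ⋆-representation of `X` by bounded operators on an inner product space `E`
(which need not be complete, so the ⋆-condition is expressed through the inner product). -/
structure BoundedRep (X : Type u) [Ring X] [StarRing X] [Algebra ℂ X]
    (E : Type v) [NormedAddCommGroup E] [InnerProductSpace ℂ E] where
  toAlgHom : X →ₐ[ℂ] (E →L[ℂ] E)
  inner_left : ∀ x v w, ⟪toAlgHom x v, w⟫_ℂ = ⟪v, toAlgHom (star x) w⟫_ℂ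

namespace BoundedRep

section

variable {X : Type*} [Ring X] [StarRing X] [Algebra ℂ X]
  {Y : Type*} [Ring Y] [StarRing Y] [Algebra ℂ Y]
  {E : Type*} [NormedAddCommGroup E] [InnerProductSpace ℂ E]
  {F : Type*} [NormedAddCommGroup F] [InnerProductSpace ℂ F]

/-- A ⋆-homomorphism into the bounded operators on a Hilbert space. -/
def ofStarAlgHom [CompleteSpace E] (π : X →⋆ₐ[ℂ] (E →L[ℂ] E)) : BoundedRep X E where
  toAlgHom := π
  inner_left x v w := by
    have : π (star x) = ContinuousLinearMap.adjoint (π x) := map_star π x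
    simp [this, ContinuousLinearMap.adjoint_inner_right]

theorem norm_le_star (π : BoundedRep X E) (x : X) :
    ‖π.toAlgHom x‖ * ‖π.toAlgHom x‖ ≤ ‖π.toAlgHom (star x * x)‖ := by
  have h : ‖π.toAlgHom x‖ ≤ Real.sqrt ‖π.toAlgHom (star x * x)‖ := by
    refine ContinuousLinearMap.opNorm_le_bound _ (Real.sqrt_nonneg _) fun v => ?_
    refine abs_le_of_sq_le_sq' ?_ (by positivity) |>.2
    rw [mul_pow, Real.sq_sqrt (norm_nonneg _)]
    calc ‖π.toAlgHom x v‖ ^ 2 = ‖⟪π.toAlgHom x v, π.toAlgHom x v⟫_ℂ‖ := by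
          rw [inner_self_eq_norm_sq_to_K]; simp
      _ = ‖⟪v, π.toAlgHom (star x * x) v⟫_ℂ‖ := by rw [π.inner_left, map_mul]; rfl
      _ ≤ ‖v‖ * (‖π.toAlgHom (star x * x)‖ * ‖v‖) :=
          (norm_inner_le_norm _ _).trans
            (mul_le_mul_of_nonneg_left (ContinuousLinearMap.le_opNorm _ _) (norm_nonneg _))
      _ = _ := by ring
  calc _ ≤ _ := mul_le_mul h h (norm_nonneg _) (Real.sqrt_nonneg _)
    _ = _ := Real.mul_self_sqrt (norm_nonneg _)

theorem norm_star (π : BoundedRep X E) (x : X) : ‖π.toAlgHom (star x)‖ = ‖π.toAlgHom x‖ := by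
  have key : ∀ x, ‖π.toAlgHom x‖ ≤ ‖π.toAlgHom (star x)‖ := fun x => by
    by_cases h : ‖π.toAlgHom x‖ = 0
    · rw [h]; exact norm_nonneg _
    · refine le_of_mul_le_mul_right ((π.norm_le_star x).trans ?_)
        (lt_of_le_of_ne (norm_nonneg _) (Ne.symm h))
      rw [map_mul]; exact norm_mul_le _ _
  exact le_antisymm (by simpa using key (star x)) (key x)

/-- The operator norm of a representation is a C⋆-seminorm. -/
def seminorm (π : BoundedRep X E) : CStarSeminorm X where
  toFun x := ‖π.toAlgHom x‖
  map_zero' := by simp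
  add_le' x y := by rw [map_add]; exact norm_add_le _ _
  neg' x := by simp
  smul' a x := by rw [map_smul, norm_smul]
  mul_le' x y := by rw [map_mul]; exact norm_mul_le _ _
  star_mul_self' x := by
    refine le_antisymm ?_ (π.norm_le_star x)
    rw [map_mul]
    exact (norm_mul_le _ _).trans (by rw [π.norm_star])

/-- The algebra homomorphism `x ↦ π x ⊗ 1`. -/
def ampLeft (π : BoundedRep X E) (F : Type*) [NormedAddCommGroup F] [InnerProductSpace ℂ F] :
    X →ₐ[ℂ] (E ⊗[ℂ] F →L[ℂ] E ⊗[ℂ] F) where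
  toFun x := (π.toAlgHom x).rTensor F
  map_one' := by simp
  map_mul' x y := by simp [ContinuousLinearMap.rTensor_mul]
  map_zero' := by simp
  map_add' := by simp
  commutes' r := by simp [Algebra.algebraMap_eq_smul_one]

/-- The algebra homomorphism `y ↦ 1 ⊗ ρ y`. -/
def ampRight (ρ : BoundedRep Y F) (E : Type*) [NormedAddCommGroup E] [InnerProductSpace ℂ E] :
    Y →ₐ[ℂ] (E ⊗[ℂ] F →L[ℂ] E ⊗[ℂ] F) where
  toFun y := (ρ.toAlgHom y).lTensor E
  map_one' := by simp
  map_mul' x y := by simp [ContinuousLinearMap.lTensor_mul]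
  map_zero' := by simp
  map_add' := by simp
  commutes' r := by simp [Algebra.algebraMap_eq_smul_one]

theorem amp_commute (π : BoundedRep X E) (ρ : BoundedRep Y F) (x : X) (y : Y) :
    Commute (π.ampLeft F x) (ρ.ampRight E y) := by
  refine ContinuousLinearMap.ext fun t => ?_
  induction t with
  | zero => simp
  | add s t hs ht => rw [map_add, map_add, hs, ht]
  | tmul v w => rfl

/-- The algebra homomorphism underlying `π ⊗ ρ`. -/
def tensorAlgHom (π : BoundedRep X E) (ρ : BoundedRep Y F) :
    X ⊗[ℂ] Y →ₐ[ℂ] (E ⊗[ℂ] F →L[ℂ] E ⊗[ℂ] F) :=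
  Algebra.TensorProduct.lift (π.ampLeft F) (ρ.ampRight E) (π.amp_commute ρ)

theorem tensorAlgHom_tmul (π : BoundedRep X E) (ρ : BoundedRep Y F) (x : X) (y : Y) :
    π.tensorAlgHom ρ (x ⊗ₜ y) = (π.toAlgHom x).rTensor F * (ρ.toAlgHom y).lTensor E :=
  Algebra.TensorProduct.lift_tmul ..

theorem tensorAlgHom_tmul_tmul (π : BoundedRep X E) (ρ : BoundedRep Y F) (x : X) (y : Y)
    (v : E) (w : F) :
    π.tensorAlgHom ρ (x ⊗ₜ y) (v ⊗ₜ w) = π.toAlgHom x v ⊗ₜ ρ.toAlgHom y w := by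
  rw [tensorAlgHom_tmul]; rfl

/-- The representation `π ⊗ ρ` of `X ⊗ Y` on `E ⊗ F`, `(π ⊗ ρ)(x ⊗ y) = π x ⊗ ρ y`. -/
def tensor [StarModule ℂ X] [StarModule ℂ Y] (π : BoundedRep X E) (ρ : BoundedRep Y F) :
    BoundedRep (X ⊗[ℂ] Y) (E ⊗[ℂ] F) where
  toAlgHom := π.tensorAlgHom ρ
  inner_left z s t := by
    induction z with
    | zero => simp
    | add a b ha hb =>
      rw [star_add, map_add, map_add, _root_.add_apply, _root_.add_apply,
        inner_add_left, inner_add_right, ha, hb]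
    | tmul x y =>
      rw [TensorProduct.star_tmul]
      induction s with
      | zero => simp
      | add a b ha hb => rw [map_add, inner_add_left, inner_add_left, ha, hb]
      | tmul v w =>
        induction t with
        | zero => simp
        | add a b ha hb => rw [map_add, inner_add_right, inner_add_right, ha, hb]
        | tmul v' w' =>
          rw [tensorAlgHom_tmul_tmul, tensorAlgHom_tmul_tmul, TensorProduct.inner_tmul,
            TensorProduct.inner_tmul, π.inner_left, ρ.inner_left]

theorem tensor_tmul_tmul [StarModule ℂ X] [StarModule ℂ Y] (π : BoundedRep X E)
    (ρ : BoundedRep Y F) (x : X) (y : Y) (v : E) (w : F) :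
    (π.tensor ρ).toAlgHom (x ⊗ₜ y) (v ⊗ₜ w) = π.toAlgHom x v ⊗ₜ ρ.toAlgHom y w :=
  π.tensorAlgHom_tmul_tmul ρ x y v w

theorem tensor_norm_tmul_le [StarModule ℂ X] [StarModule ℂ Y] (π : BoundedRep X E) (ρ : BoundedRep Y F) (x : X) (y : Y) :
    ‖(π.tensor ρ).toAlgHom (x ⊗ₜ y)‖ ≤ ‖π.toAlgHom x‖ * ‖ρ.toAlgHom y‖ := by
  rw [show (π.tensor ρ).toAlgHom (x ⊗ₜ y) = _ from π.tensorAlgHom_tmul ρ x y]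
  exact (norm_mul_le _ _).trans (mul_le_mul (ContinuousLinearMap.norm_rTensor_le _ _)
    (ContinuousLinearMap.norm_lTensor_le _ _) (norm_nonneg _) (norm_nonneg _))

/-- The extension of a representation to the Hilbert space completion. -/
def completion (π : BoundedRep X E) :
    X →⋆ₐ[ℂ] (UniformSpace.Completion E →L[ℂ] UniformSpace.Completion E) where
  toFun x := (π.toAlgHom x).completion
  map_one' := by
    refine ContinuousLinearMap.ext fun c => ?_
    induction c using UniformSpace.Completion.induction_on with
    | hp => apply isClosed_eq <;> fun_prop
    | ih c => simp
  map_mul' x y := by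
    refine ContinuousLinearMap.ext fun c => ?_
    induction c using UniformSpace.Completion.induction_on with
    | hp => apply isClosed_eq <;> fun_prop
    | ih c => simp
  map_zero' := by
    refine ContinuousLinearMap.ext fun c => ?_
    induction c using UniformSpace.Completion.induction_on with
    | hp => apply isClosed_eq <;> fun_prop
    | ih c => simp
  map_add' x y := by
    refine ContinuousLinearMap.ext fun c => ?_
    induction c using UniformSpace.Completion.induction_on with
    | hp => apply isClosed_eq <;> fun_prop
    | ih c => simp [UniformSpace.Completion.coe_add]
  commutes' r := by
    refine ContinuousLinearMap.ext fun c => ?_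
    induction c using UniformSpace.Completion.induction_on with
    | hp => apply isClosed_eq <;> fun_prop
    | ih c => simp [Algebra.algebraMap_eq_smul_one]
  map_star' x := by
    refine (ContinuousLinearMap.eq_adjoint_iff (π.toAlgHom (star x)).completion
      (π.toAlgHom x).completion).mpr ?_
    intro v w
    induction v, w using UniformSpace.Completion.induction_on₂ with
    | hp => apply isClosed_eq <;> fun_prop
    | ih v w => simpa using π.inner_left (star x) v w

theorem completion_coe (π : BoundedRep X E) (x : X) (v : E) :
    π.completion x (v : UniformSpace.Completion E) = (π.toAlgHom x v : UniformSpace.Completion E) :=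
  ContinuousLinearMap.completion_apply_coe _ _

theorem norm_completion_le (π : BoundedRep X E) (x : X) : ‖π.completion x‖ ≤ ‖π.toAlgHom x‖ := by
  refine ContinuousLinearMap.opNorm_le_bound _ (norm_nonneg _) fun c => ?_
  induction c using UniformSpace.Completion.induction_on with
  | hp => apply isClosed_le <;> fun_prop
  | ih c =>
    rw [completion_coe, UniformSpace.Completion.norm_coe, UniformSpace.Completion.norm_coe]
    exact ContinuousLinearMap.le_opNorm _ _

end

end BoundedRep

/-- A representation of a unital C⋆-algebra on a Hilbert space. -/
structure HilbertRep (A : Type u) [CStarAlgebra A] where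
  H : Type u
  [normedAddCommGroup : NormedAddCommGroup H]
  [innerProductSpace : InnerProductSpace ℂ H]
  [completeSpace : CompleteSpace H]
  π : A →⋆ₐ[ℂ] (H →L[ℂ] H)

attribute [instance] HilbertRep.normedAddCommGroup HilbertRep.innerProductSpace
  HilbertRep.completeSpace

namespace HilbertRep

variable {A B : Type u} [CStarAlgebra A] [CStarAlgebra B]

instance : Nonempty (HilbertRep A) :=
  ⟨{ H := PUnit
     π :=
      { toFun := fun _ => 0
        map_one' := Subsingleton.elim _ _
        map_mul' := fun _ _ => Subsingleton.elim _ _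
        map_zero' := rfl
        map_add' := fun _ _ => Subsingleton.elim _ _
        commutes' := fun _ => Subsingleton.elim _ _
        map_star' := fun _ => Subsingleton.elim _ _ } }⟩

/-- The underlying bounded representation. -/
def rep (r : HilbertRep A) : BoundedRep A r.H := BoundedRep.ofStarAlgHom r.π

theorem norm_rep_le (r : HilbertRep A) (a : A) : ‖r.rep.toAlgHom a‖ ≤ ‖a‖ :=
  NonUnitalStarAlgHom.norm_apply_le r.π a

/-- Pull back along a unital ⋆-homomorphism. -/
def comap (r : HilbertRep B) (φ : A →⋆ₐ[ℂ] B) : HilbertRep A where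
  H := r.H
  π := r.π.comp φ

end HilbertRep

section MinTensor

variable (A B C : Type u) [CStarAlgebra A] [CStarAlgebra B] [CStarAlgebra C]

/-- The spatial (minimal) C⋆-seminorm on the algebraic tensor product,
`‖x‖ = sup ‖(π ⊗ ρ)(x)‖` over all Hilbert space representations `π` of `A` and `ρ` of `B`; the
operator norm is computed on the dense subspace `H_π ⊗ H_ρ` of the Hilbert space tensor product. -/
def minSeminorm : CStarSeminorm (A ⊗[ℂ] B) :=
  CStarSeminorm.iSup (ι := HilbertRep A × HilbertRep B)
    (fun r => (r.1.rep.tensor r.2.rep).seminorm) (fun x => by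
      induction x with
      | zero => exact ⟨0, by rintro _ ⟨r, rfl⟩; simp⟩
      | tmul a b =>
        refine ⟨‖a‖ * ‖b‖, ?_⟩
        rintro _ ⟨r, rfl⟩
        exact (r.1.rep.tensor_norm_tmul_le r.2.rep a b).trans
          (mul_le_mul (r.1.norm_rep_le a) (r.2.norm_rep_le b) (norm_nonneg _) (norm_nonneg _))
      | add x y hx hy =>
        obtain ⟨c, hc⟩ := hx
        obtain ⟨d, hd⟩ := hy
        refine ⟨c + d, ?_⟩
        rintro _ ⟨r, rfl⟩
        exact (map_add_le_add (r.1.rep.tensor r.2.rep).seminorm.toSeminorm x y).trans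
          (add_le_add (hc ⟨r, rfl⟩) (hd ⟨r, rfl⟩)))

/-- The threefold spatial C⋆-seminorm, `‖x‖ = sup ‖(π ⊗ ρ ⊗ τ)(x)‖`. -/
def minSeminorm₃ : CStarSeminorm ((A ⊗[ℂ] B) ⊗[ℂ] C) :=
  CStarSeminorm.iSup (ι := HilbertRep A × HilbertRep B × HilbertRep C)
    (fun r => ((r.1.rep.tensor r.2.1.rep).tensor r.2.2.rep).seminorm) (fun x => by
      induction x with
      | zero => exact ⟨0, by rintro _ ⟨r, rfl⟩; simp⟩
      | tmul y c =>
        refine ⟨minSeminorm A B y * ‖c‖, ?_⟩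
        rintro _ ⟨r, rfl⟩
        exact ((r.1.rep.tensor r.2.1.rep).tensor_norm_tmul_le r.2.2.rep y c).trans
          (mul_le_mul (CStarSeminorm.le_iSup
            (fun r : HilbertRep A × HilbertRep B => (r.1.rep.tensor r.2.rep).seminorm) _
              (r.1, r.2.1) y)
            (r.2.2.norm_rep_le c) (norm_nonneg _) (CStarSeminorm.nonneg _ _))
      | add x y hx hy =>
        obtain ⟨c, hc⟩ := hx
        obtain ⟨d, hd⟩ := hy
        refine ⟨c + d, ?_⟩
        rintro _ ⟨r, rfl⟩
        exact (map_add_le_add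
          ((r.1.rep.tensor r.2.1.rep).tensor r.2.2.rep).seminorm.toSeminorm x y).trans
          (add_le_add (hc ⟨r, rfl⟩) (hd ⟨r, rfl⟩)))

/-- The minimal (spatial) tensor product of two unital C⋆-algebras. -/
def MinTensor : Type u := (minSeminorm A B).Completion

instance : CStarAlgebra (MinTensor A B) :=
  inferInstanceAs (CStarAlgebra (minSeminorm A B).Completion)

/-- The threefold minimal (spatial) tensor product of unital C⋆-algebras. -/
def MinTensor₃ : Type u := (minSeminorm₃ A B C).Completion

instance : CStarAlgebra (MinTensor₃ A B C) :=
  inferInstanceAs (CStarAlgebra (minSeminorm₃ A B C).Completion)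

end MinTensor

section StarTensor

variable {X Y X' Y' D : Type*} [Ring X] [StarRing X] [Algebra ℂ X] [StarModule ℂ X]
  [Ring Y] [StarRing Y] [Algebra ℂ Y] [StarModule ℂ Y]
  [Ring X'] [StarRing X'] [Algebra ℂ X'] [StarModule ℂ X']
  [Ring Y'] [StarRing Y'] [Algebra ℂ Y'] [StarModule ℂ Y']
  [Ring D] [StarRing D] [Algebra ℂ D]

/-- Two commuting ⋆-homomorphisms `f`, `g` give the ⋆-homomorphism `x ⊗ y ↦ f x * g y` on the
algebraic tensor product. -/
def starLift (f : X →⋆ₐ[ℂ] D) (g : Y →⋆ₐ[ℂ] D) (h : ∀ x y, Commute (f x) (g y)) :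
    X ⊗[ℂ] Y →⋆ₐ[ℂ] D where
  toAlgHom := Algebra.TensorProduct.lift f.toAlgHom g.toAlgHom h
  map_star' z := by
    induction z with
    | zero => simp
    | add a b ha hb =>
      simp only [AlgHom.toRingHom_eq_coe, RingHom.toMonoidHom_eq_coe, OneHom.toFun_eq_coe,
        MonoidHom.toOneHom_coe, MonoidHom.coe_coe, RingHom.coe_coe, star_add, map_add] at ha hb ⊢
      rw [ha, hb]
    | tmul x y =>
      change Algebra.TensorProduct.lift f.toAlgHom g.toAlgHom h (star (x ⊗ₜ y)) =
        star (Algebra.TensorProduct.lift f.toAlgHom g.toAlgHom h (x ⊗ₜ y))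
      rw [TensorProduct.star_tmul, Algebra.TensorProduct.lift_tmul, Algebra.TensorProduct.lift_tmul,
        star_mul]
      change f (star x) * g (star y) = star (g y) * star (f x)
      rw [(h (star x) (star y)).eq, map_star, map_star]

theorem starLift_tmul (f : X →⋆ₐ[ℂ] D) (g : Y →⋆ₐ[ℂ] D) (h : ∀ x y, Commute (f x) (g y))
    (x : X) (y : Y) : starLift f g h (x ⊗ₜ y) = f x * g y :=
  Algebra.TensorProduct.lift_tmul (f := f.toAlgHom) (g := g.toAlgHom) (hfg := h) x y

/-- The ⋆-homomorphism `x ⊗ y ↦ f x ⊗ g y` of algebraic tensor products. -/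
def starMap (f : X →⋆ₐ[ℂ] X') (g : Y →⋆ₐ[ℂ] Y') : X ⊗[ℂ] Y →⋆ₐ[ℂ] X' ⊗[ℂ] Y' where
  toAlgHom := Algebra.TensorProduct.map f.toAlgHom g.toAlgHom
  map_star' z := by
    change Algebra.TensorProduct.map f.toAlgHom g.toAlgHom (star z) =
        star (Algebra.TensorProduct.map f.toAlgHom g.toAlgHom z)
    induction z with
    | zero => simp
    | add a b ha hb => rw [star_add, map_add, map_add, star_add, ha, hb]
    | tmul x y =>
      simp only [TensorProduct.star_tmul, Algebra.TensorProduct.map_tmul]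
      exact congrArg₂ _ (map_star f x) (map_star g y)

theorem starMap_tmul (f : X →⋆ₐ[ℂ] X') (g : Y →⋆ₐ[ℂ] Y') (x : X) (y : Y) :
    starMap f g (x ⊗ₜ y) = f x ⊗ₜ g y :=
  Algebra.TensorProduct.map_tmul ..

/-- Pull back of a representation along a ⋆-homomorphism. -/
def BoundedRep.comap {E : Type*} [NormedAddCommGroup E] [InnerProductSpace ℂ E]
    (π : BoundedRep X' E) (φ : X →⋆ₐ[ℂ] X') : BoundedRep X E where
  toAlgHom := π.toAlgHom.comp φ.toAlgHom
  inner_left x v w := (π.inner_left (φ x) v w).trans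
    (congrArg (fun y => ⟪v, π.toAlgHom y w⟫_ℂ) (map_star φ x).symm)

theorem BoundedRep.tensor_comap {E F : Type*} [NormedAddCommGroup E] [InnerProductSpace ℂ E]
    [NormedAddCommGroup F] [InnerProductSpace ℂ F] (π : BoundedRep X' E) (ρ : BoundedRep Y' F)
    (φ : X →⋆ₐ[ℂ] X') (ψ : Y →⋆ₐ[ℂ] Y') :
    (π.tensor ρ).comap (starMap φ ψ) = (π.comap φ).tensor (ρ.comap ψ) := by
  have h : ((π.tensor ρ).comap (starMap φ ψ)).toAlgHom =
      ((π.comap φ).tensor (ρ.comap ψ)).toAlgHom := by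
    refine AlgHom.ext fun x => ?_
    induction x with
    | zero => simp only [map_zero]
    | add x y hx hy => rw [map_add, map_add, hx, hy]
    | tmul a b =>
      refine Eq.trans ?_ ((π.comap φ).tensorAlgHom_tmul (ρ.comap ψ) a b).symm
      exact (congrArg (π.tensorAlgHom ρ) (starMap_tmul φ ψ a b)).trans
        (π.tensorAlgHom_tmul ρ (φ a) (ψ b))
  generalize (π.tensor ρ).comap (starMap φ ψ) = p at h ⊢
  generalize (π.comap φ).tensor (ρ.comap ψ) = q at h ⊢
  cases p; cases q; cases h; rfl

end StarTensor

theorem norm_le_of_intertwine {E F : Type*} [NormedAddCommGroup E] [InnerProductSpace ℂ E]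
    [NormedAddCommGroup F] [InnerProductSpace ℂ F] (V : E →ₗᵢ[ℂ] F) (S : E →L[ℂ] E)
    (T : F →L[ℂ] F) (h : ∀ v, V (S v) = T (V v)) : ‖S‖ ≤ ‖T‖ := by
  refine ContinuousLinearMap.opNorm_le_bound _ (norm_nonneg _) fun v => ?_
  rw [← V.norm_map (S v), h, ← V.norm_map v]
  exact T.le_opNorm _

theorem le_minSeminorm {A B : Type u} [CStarAlgebra A] [CStarAlgebra B] (r : HilbertRep A)
    (s : HilbertRep B) (x : A ⊗[ℂ] B) :
    ‖(r.rep.tensor s.rep).toAlgHom x‖ ≤ minSeminorm A B x :=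
  CStarSeminorm.le_iSup
    (fun r : HilbertRep A × HilbertRep B => (r.1.rep.tensor r.2.rep).seminorm) _ (r, s) x

theorem le_minSeminorm₃ {A B C : Type u} [CStarAlgebra A] [CStarAlgebra B] [CStarAlgebra C]
    (r : HilbertRep A) (s : HilbertRep B) (t : HilbertRep C) (x : (A ⊗[ℂ] B) ⊗[ℂ] C) :
    ‖((r.rep.tensor s.rep).tensor t.rep).toAlgHom x‖ ≤ minSeminorm₃ A B C x :=
  CStarSeminorm.le_iSup (fun r : HilbertRep A × HilbertRep B × HilbertRep C =>
    ((r.1.rep.tensor r.2.1.rep).tensor r.2.2.rep).seminorm) _ (r, s, t) x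

theorem minSeminorm_le {A B : Type u} [CStarAlgebra A] [CStarAlgebra B] {x : A ⊗[ℂ] B} {c : ℝ}
    (h : ∀ (r : HilbertRep A) (s : HilbertRep B), ‖(r.rep.tensor s.rep).toAlgHom x‖ ≤ c) :
    minSeminorm A B x ≤ c :=
  CStarSeminorm.iSup_le _ _ fun r => h r.1 r.2

theorem minSeminorm₃_le {A B C : Type u} [CStarAlgebra A] [CStarAlgebra B] [CStarAlgebra C]
    {x : (A ⊗[ℂ] B) ⊗[ℂ] C} {c : ℝ}
    (h : ∀ (r : HilbertRep A) (s : HilbertRep B) (t : HilbertRep C),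
      ‖((r.rep.tensor s.rep).tensor t.rep).toAlgHom x‖ ≤ c) :
    minSeminorm₃ A B C x ≤ c :=
  CStarSeminorm.iSup_le _ _ fun r => h r.1 r.2.1 r.2.2

theorem minSeminorm_tmul_le {A B : Type u} [CStarAlgebra A] [CStarAlgebra B] (a : A) (b : B) :
    minSeminorm A B (a ⊗ₜ b) ≤ ‖a‖ * ‖b‖ :=
  minSeminorm_le fun r s => (r.rep.tensor_norm_tmul_le s.rep a b).trans
    (mul_le_mul (r.norm_rep_le a) (s.norm_rep_le b) (norm_nonneg _) (norm_nonneg _))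

/-- The inclusion of the algebraic tensor product into the minimal tensor product. -/
def MinTensor.of (A B : Type u) [CStarAlgebra A] [CStarAlgebra B] :
    A ⊗[ℂ] B →⋆ₐ[ℂ] MinTensor A B :=
  (minSeminorm A B).of

/-- The inclusion of the algebraic threefold tensor product into the minimal one. -/
def MinTensor₃.of (A B C : Type u) [CStarAlgebra A] [CStarAlgebra B] [CStarAlgebra C] :
    (A ⊗[ℂ] B) ⊗[ℂ] C →⋆ₐ[ℂ] MinTensor₃ A B C :=
  (minSeminorm₃ A B C).of

namespace MinTensor

variable {A B C A' B' C' D : Type u} [CStarAlgebra A] [CStarAlgebra B] [CStarAlgebra C]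
  [CStarAlgebra A'] [CStarAlgebra B'] [CStarAlgebra C'] [CStarAlgebra D]

/-- The elementary tensor `a ⊗ b`. -/
def tmul (a : A) (b : B) : MinTensor A B := of A B (a ⊗ₜ b)

theorem norm_of (x : A ⊗[ℂ] B) : ‖of A B x‖ = minSeminorm A B x := (minSeminorm A B).norm_of x

theorem denseRange_of : DenseRange (of A B) := (minSeminorm A B).denseRange_of

/-- Extension of a bounded ⋆-homomorphism from the algebraic to the minimal tensor product. -/
def lift (f : A ⊗[ℂ] B →⋆ₐ[ℂ] D) (hf : ∀ x, ‖f x‖ ≤ minSeminorm A B x) : MinTensor A B →⋆ₐ[ℂ] D :=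
  (minSeminorm A B).lift f hf

theorem lift_of (f : A ⊗[ℂ] B →⋆ₐ[ℂ] D) (hf : ∀ x, ‖f x‖ ≤ minSeminorm A B x) (x : A ⊗[ℂ] B) :
    lift f hf (of A B x) = f x :=
  (minSeminorm A B).lift_of f hf x

theorem minSeminorm_starMap_le (φ : A →⋆ₐ[ℂ] A') (ψ : B →⋆ₐ[ℂ] B') (x : A ⊗[ℂ] B) :
    minSeminorm A' B' (starMap φ ψ x) ≤ minSeminorm A B x :=
  minSeminorm_le fun r s => by
    change ‖((r.rep.tensor s.rep).comap (starMap φ ψ)).toAlgHom x‖ ≤ _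
    rw [BoundedRep.tensor_comap]
    exact le_minSeminorm (r.comap φ) (s.comap ψ) x

/-- The tensor product `φ ⊗ ψ` of unital ⋆-homomorphisms. -/
def map (φ : A →⋆ₐ[ℂ] A') (ψ : B →⋆ₐ[ℂ] B') : MinTensor A B →⋆ₐ[ℂ] MinTensor A' B' :=
  lift ((of A' B').comp (starMap φ ψ)) fun x => by
    exact (norm_of _).le.trans (minSeminorm_starMap_le φ ψ x)

theorem map_of (φ : A →⋆ₐ[ℂ] A') (ψ : B →⋆ₐ[ℂ] B') (x : A ⊗[ℂ] B) :
    map φ ψ (of A B x) = of A' B' (starMap φ ψ x) :=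
  lift_of ..

theorem map_tmul (φ : A →⋆ₐ[ℂ] A') (ψ : B →⋆ₐ[ℂ] B') (a : A) (b : B) :
    map φ ψ (tmul a b) = tmul (φ a) (ψ b) := by
  rw [tmul, map_of, starMap_tmul]; rfl

theorem hom_continuous (f : A →⋆ₐ[ℂ] D) : Continuous f :=
  AddMonoidHomClass.continuous_of_bound f 1 fun x => by
    rw [one_mul]; exact NonUnitalStarAlgHom.norm_apply_le f x

/-- ⋆-homomorphisms on a minimal tensor product are determined by elementary tensors. -/
theorem hom_ext {f g : MinTensor A B →⋆ₐ[ℂ] D} (h : ∀ a b, f (tmul a b) = g (tmul a b)) :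
    f = g := by
  refine StarAlgHom.ext fun t => ?_
  refine denseRange_of.induction_on t
    (isClosed_eq (hom_continuous f) (hom_continuous g)) fun x => ?_
  induction x with
  | zero => simp only [map_zero]
  | add x y hx hy => simp only [map_add, hx, hy]
  | tmul a b => exact h a b

theorem map_comp_map {A'' B'' : Type u} [CStarAlgebra A''] [CStarAlgebra B'']
    (φ' : A' →⋆ₐ[ℂ] A'') (ψ' : B' →⋆ₐ[ℂ] B'') (φ : A →⋆ₐ[ℂ] A') (ψ : B →⋆ₐ[ℂ] B') :
    (map φ' ψ').comp (map φ ψ) = map (φ'.comp φ) (ψ'.comp ψ) :=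
  hom_ext fun a b => by simp [map_tmul]

theorem norm_completion_tensor_le (r : HilbertRep A) (s : HilbertRep B) (x : A ⊗[ℂ] B) :
    ‖(r.rep.tensor s.rep).completion x‖ ≤ minSeminorm A B x :=
  ((r.rep.tensor s.rep).norm_completion_le x).trans (le_minSeminorm r s x)

/-- The representation `π ⊗ ρ` of the minimal tensor product on the Hilbert space tensor
product. -/
def prodRep (r : HilbertRep A) (s : HilbertRep B) : HilbertRep (MinTensor A B) where
  H := UniformSpace.Completion (r.H ⊗[ℂ] s.H)
  π := lift (r.rep.tensor s.rep).completion (norm_completion_tensor_le r s)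

theorem prodRep_of_coe (r : HilbertRep A) (s : HilbertRep B) (x : A ⊗[ℂ] B) (v : r.H ⊗[ℂ] s.H) :
    (prodRep r s).rep.toAlgHom (of A B x) (v : UniformSpace.Completion (r.H ⊗[ℂ] s.H)) =
      ((r.rep.tensor s.rep).toAlgHom x v : UniformSpace.Completion (r.H ⊗[ℂ] s.H)) := by
  have h : (prodRep r s).π (of A B x) = (r.rep.tensor s.rep).completion x :=
    lift_of _ (norm_completion_tensor_le r s) x
  exact (congrArg (fun T => T (v : UniformSpace.Completion (r.H ⊗[ℂ] s.H))) h).trans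
    ((r.rep.tensor s.rep).completion_coe x v)

end MinTensor

namespace MinTensor₃

open MinTensor (tmul)

variable {A B C A' B' C' D : Type u} [CStarAlgebra A] [CStarAlgebra B] [CStarAlgebra C]
  [CStarAlgebra A'] [CStarAlgebra B'] [CStarAlgebra C'] [CStarAlgebra D]

theorem norm_of (x : (A ⊗[ℂ] B) ⊗[ℂ] C) : ‖of A B C x‖ = minSeminorm₃ A B C x :=
  (minSeminorm₃ A B C).norm_of x

theorem denseRange_of : DenseRange (of A B C) := (minSeminorm₃ A B C).denseRange_of

theorem minSeminorm₃_starMap_le (φ : A →⋆ₐ[ℂ] A') (ψ : B →⋆ₐ[ℂ] B') (χ : C →⋆ₐ[ℂ] C')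
    (x : (A ⊗[ℂ] B) ⊗[ℂ] C) :
    minSeminorm₃ A' B' C' (starMap (starMap φ ψ) χ x) ≤ minSeminorm₃ A B C x :=
  minSeminorm₃_le fun r s t => by
    change ‖(((r.rep.tensor s.rep).tensor t.rep).comap (starMap (starMap φ ψ) χ)).toAlgHom x‖ ≤ _
    rw [BoundedRep.tensor_comap, BoundedRep.tensor_comap]
    exact le_minSeminorm₃ (r.comap φ) (s.comap ψ) (t.comap χ) x

/-- The threefold tensor product `φ ⊗ ψ ⊗ χ` of unital ⋆-homomorphisms. -/
def map (φ : A →⋆ₐ[ℂ] A') (ψ : B →⋆ₐ[ℂ] B') (χ : C →⋆ₐ[ℂ] C') :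
    MinTensor₃ A B C →⋆ₐ[ℂ] MinTensor₃ A' B' C' :=
  (minSeminorm₃ A B C).lift ((of A' B' C').comp (starMap (starMap φ ψ) χ)) fun x =>
    (norm_of _).le.trans (minSeminorm₃_starMap_le φ ψ χ x)

theorem map_of (φ : A →⋆ₐ[ℂ] A') (ψ : B →⋆ₐ[ℂ] B') (χ : C →⋆ₐ[ℂ] C') (x : (A ⊗[ℂ] B) ⊗[ℂ] C) :
    map φ ψ χ (of A B C x) = of A' B' C' (starMap (starMap φ ψ) χ x) :=
  (minSeminorm₃ A B C).lift_of ..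

end MinTensor₃

section Assoc

variable (A B C : Type u) [CStarAlgebra A] [CStarAlgebra B] [CStarAlgebra C]

namespace MinTensor₃

/-- `x ↦ x ⊗ 1`, from `A ⊗ B` to `A ⊗ B ⊗ C`. -/
def inclLeft₀ : A ⊗[ℂ] B →⋆ₐ[ℂ] MinTensor₃ A B C :=
  (of A B C).comp
    { Algebra.TensorProduct.includeLeft with
      map_star' := fun x => by
        change star x ⊗ₜ[ℂ] (1 : C) = star (x ⊗ₜ[ℂ] (1 : C))
        rw [TensorProduct.star_tmul, star_one] }

/-- `y ↦ 1 ⊗ y`, from `B ⊗ C` to `A ⊗ B ⊗ C`. -/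
def inclRight₀ : B ⊗[ℂ] C →⋆ₐ[ℂ] MinTensor₃ A B C :=
  (of A B C).comp (starMap
    { (Algebra.TensorProduct.includeRight : B →ₐ[ℂ] A ⊗[ℂ] B) with
      map_star' := fun x => by
        change (1 : A) ⊗ₜ[ℂ] star x = star ((1 : A) ⊗ₜ[ℂ] x)
        rw [TensorProduct.star_tmul, star_one] } (StarAlgHom.id ℂ C))

/-- `a ↦ a ⊗ 1 ⊗ 1`. -/
def inclFirst : A →⋆ₐ[ℂ] MinTensor₃ A B C :=
  (inclLeft₀ A B C).comp
    { (Algebra.TensorProduct.includeLeft : A →ₐ[ℂ] A ⊗[ℂ] B) with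
      map_star' := fun x => by
        change star x ⊗ₜ[ℂ] (1 : B) = star (x ⊗ₜ[ℂ] (1 : B))
        rw [TensorProduct.star_tmul, star_one] }

/-- `c ↦ 1 ⊗ 1 ⊗ c`. -/
def inclLast : C →⋆ₐ[ℂ] MinTensor₃ A B C :=
  (inclRight₀ A B C).comp
    { (Algebra.TensorProduct.includeRight : C →ₐ[ℂ] B ⊗[ℂ] C) with
      map_star' := fun x => by
        change (1 : B) ⊗ₜ[ℂ] star x = star ((1 : B) ⊗ₜ[ℂ] x)
        rw [TensorProduct.star_tmul, star_one] }

variable {A B C}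

theorem inclLeft₀_apply (x : A ⊗[ℂ] B) : inclLeft₀ A B C x = of A B C (x ⊗ₜ 1) := rfl

theorem inclRight₀_tmul (b : B) (c : C) :
    inclRight₀ A B C (b ⊗ₜ c) = of A B C ((1 ⊗ₜ b) ⊗ₜ c) :=
  congrArg (of A B C) (starMap_tmul _ _ b c)

theorem inclFirst_apply (a : A) : inclFirst A B C a = of A B C ((a ⊗ₜ 1) ⊗ₜ 1) := rfl

theorem inclLast_apply (c : C) : inclLast A B C c = of A B C (1 ⊗ₜ c) :=
  inclRight₀_tmul 1 c

theorem norm_inclLeft₀_le (x : A ⊗[ℂ] B) : ‖inclLeft₀ A B C x‖ ≤ minSeminorm A B x := by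
  rw [inclLeft₀_apply, norm_of]
  refine minSeminorm₃_le fun r s t => ?_
  have h := (r.rep.tensor s.rep).tensor_norm_tmul_le t.rep x 1
  refine h.trans ?_
  rw [map_one]
  calc _ ≤ ‖(r.rep.tensor s.rep).toAlgHom x‖ * 1 :=
        mul_le_mul_of_nonneg_left ContinuousLinearMap.norm_id_le (norm_nonneg _)
    _ ≤ _ := by rw [mul_one]; exact le_minSeminorm r s x

end MinTensor₃

end Assoc

section Intertwine

variable {X Y Z W E F L M : Type*} [Ring X] [StarRing X] [Algebra ℂ X] [StarModule ℂ X]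
  [Ring Y] [StarRing Y] [Algebra ℂ Y] [StarModule ℂ Y]
  [Ring Z] [StarRing Z] [Algebra ℂ Z] [StarModule ℂ Z]
  [Ring W] [StarRing W] [Algebra ℂ W] [StarModule ℂ W]
  [NormedAddCommGroup E] [InnerProductSpace ℂ E] [NormedAddCommGroup F] [InnerProductSpace ℂ F]
  [NormedAddCommGroup L] [InnerProductSpace ℂ L] [NormedAddCommGroup M] [InnerProductSpace ℂ M]

theorem BoundedRep.intertwine_left (π : BoundedRep X E) (τ : BoundedRep Z L) (σ : BoundedRep W M)
    (f : X →ₗ[ℂ] W) (V : E →ₗᵢ[ℂ] M)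
    (h : ∀ x v, V (π.toAlgHom x v) = σ.toAlgHom (f x) (V v)) (z : X ⊗[ℂ] Z) (v : E ⊗[ℂ] L) :
    TensorProduct.mapIsometry V LinearIsometry.id ((π.tensor τ).toAlgHom z v) =
      (σ.tensor τ).toAlgHom (TensorProduct.map f LinearMap.id z)
        (TensorProduct.mapIsometry V LinearIsometry.id v) := by
  induction z with
  | zero => simp only [map_zero, _root_.zero_apply]
  | add x y hx hy => simp only [map_add, _root_.add_apply, hx, hy]
  | tmul x c =>
    induction v with
    | zero => simp only [map_zero]
    | add v w hv hw => rw [map_add, map_add, map_add, map_add, hv, hw]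
    | tmul v w =>
      rw [tensor_tmul_tmul, TensorProduct.map_tmul]
      refine Eq.trans ?_ (tensor_tmul_tmul σ τ (f x) c (V v) w).symm
      exact congrArg (· ⊗ₜ[ℂ] τ.toAlgHom c w) (h x v)

theorem BoundedRep.intertwine_right (π : BoundedRep X E) (ρ : BoundedRep Y F) (τ : BoundedRep Z L)
    (σ : BoundedRep W M) (f : Y ⊗[ℂ] Z →ₗ[ℂ] W) (V : F ⊗[ℂ] L →ₗᵢ[ℂ] M)
    (h : ∀ x v, V ((ρ.tensor τ).toAlgHom x v) = σ.toAlgHom (f x) (V v))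
    (z : (X ⊗[ℂ] Y) ⊗[ℂ] Z) (v : (E ⊗[ℂ] F) ⊗[ℂ] L) :
    ((TensorProduct.mapIsometry LinearIsometry.id V).comp
        (TensorProduct.assocIsometry ℂ E F L).toLinearIsometry)
          (((π.tensor ρ).tensor τ).toAlgHom z v) =
      (π.tensor σ).toAlgHom
        (TensorProduct.map LinearMap.id f (TensorProduct.assoc ℂ X Y Z z))
        (((TensorProduct.mapIsometry LinearIsometry.id V).comp
          (TensorProduct.assocIsometry ℂ E F L).toLinearIsometry) v) := by
  induction z with
  | zero => simp only [map_zero, _root_.zero_apply]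
  | add x y hx hy => simp only [map_add, _root_.add_apply, hx, hy]
  | tmul x c =>
    induction x with
    | zero => simp only [TensorProduct.zero_tmul, map_zero, _root_.zero_apply]
    | add x y hx hy => simp only [TensorProduct.add_tmul, map_add, _root_.add_apply, hx, hy]
    | tmul a b =>
      induction v with
      | zero => simp only [map_zero]
      | add v w hv hw => rw [map_add, map_add, map_add, map_add, hv, hw]
      | tmul v z =>
        induction v with
        | zero => simp only [TensorProduct.zero_tmul, map_zero]
        | add v w hv hw =>
          rw [TensorProduct.add_tmul, map_add, map_add, map_add, map_add, hv, hw]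
        | tmul v w =>
          rw [tensor_tmul_tmul, tensor_tmul_tmul, TensorProduct.assoc_tmul, TensorProduct.map_tmul]
          refine Eq.trans ?_ (tensor_tmul_tmul π σ a (f (b ⊗ₜ c)) v (V (w ⊗ₜ z))).symm
          refine congrArg (π.toAlgHom a v ⊗ₜ[ℂ] ·) ?_
          rw [← h, tensor_tmul_tmul]
          rfl

end Intertwine

section Assoc

variable {A B C : Type u} [CStarAlgebra A] [CStarAlgebra B] [CStarAlgebra C]

namespace MinTensor₃

/-- The inclusion of `(A ⊗ B) ⊗ C` into the algebraic tensor product of the minimal tensor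
product of `A` and `B` with `C`. -/
def jLeft : (A ⊗[ℂ] B) ⊗[ℂ] C →ₗ[ℂ] MinTensor A B ⊗[ℂ] C :=
  TensorProduct.map (MinTensor.of A B : A ⊗[ℂ] B →ₗ[ℂ] MinTensor A B) LinearMap.id

/-- The inclusion of `(A ⊗ B) ⊗ C` into the algebraic tensor product of `A` with the minimal
tensor product of `B` and `C`. -/
def jRight : (A ⊗[ℂ] B) ⊗[ℂ] C →ₗ[ℂ] A ⊗[ℂ] MinTensor B C :=
  (TensorProduct.map LinearMap.id (MinTensor.of B C : B ⊗[ℂ] C →ₗ[ℂ] MinTensor B C)).comp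
    (TensorProduct.assoc ℂ A B C).toLinearMap

theorem jLeft_tmul (x : A ⊗[ℂ] B) (c : C) : jLeft (x ⊗ₜ c) = MinTensor.of A B x ⊗ₜ c := rfl

theorem jRight_tmul (a : A) (b : B) (c : C) :
    jRight ((a ⊗ₜ b) ⊗ₜ c) = a ⊗ₜ MinTensor.of B C (b ⊗ₜ c) := rfl

theorem minSeminorm₃_le_jLeft (z : (A ⊗[ℂ] B) ⊗[ℂ] C) :
    minSeminorm₃ A B C z ≤ minSeminorm (MinTensor A B) C (jLeft z) :=
  minSeminorm₃_le fun r s t =>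
    (norm_le_of_intertwine _ _ _ (BoundedRep.intertwine_left (r.rep.tensor s.rep) t.rep
      (MinTensor.prodRep r s).rep (MinTensor.of A B : A ⊗[ℂ] B →ₗ[ℂ] MinTensor A B)
      (UniformSpace.Completion.toComplₗᵢ : r.H ⊗[ℂ] s.H →ₗᵢ[ℂ] (MinTensor.prodRep r s).H)
      (fun x v => (MinTensor.prodRep_of_coe r s x v).symm) z)).trans
      (le_minSeminorm (MinTensor.prodRep r s) t (jLeft z))

theorem minSeminorm₃_le_jRight (z : (A ⊗[ℂ] B) ⊗[ℂ] C) :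
    minSeminorm₃ A B C z ≤ minSeminorm A (MinTensor B C) (jRight z) :=
  minSeminorm₃_le fun r s t =>
    (norm_le_of_intertwine _ _ _ (BoundedRep.intertwine_right r.rep s.rep t.rep
      (MinTensor.prodRep s t).rep (MinTensor.of B C : B ⊗[ℂ] C →ₗ[ℂ] MinTensor B C)
      (UniformSpace.Completion.toComplₗᵢ : s.H ⊗[ℂ] t.H →ₗᵢ[ℂ] (MinTensor.prodRep s t).H)
      (fun x v => (MinTensor.prodRep_of_coe s t x v).symm) z)).trans
      (le_minSeminorm r (MinTensor.prodRep s t) (jRight z))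

theorem norm_inclRight₀_le (y : B ⊗[ℂ] C) : ‖inclRight₀ A B C y‖ ≤ minSeminorm B C y := by
  obtain ⟨z, hz, hj⟩ : ∃ z : (A ⊗[ℂ] B) ⊗[ℂ] C,
      inclRight₀ A B C y = of A B C z ∧ jRight z = 1 ⊗ₜ MinTensor.of B C y := by
    induction y with
    | zero => exact ⟨0, by simp only [map_zero], by simp only [map_zero, TensorProduct.tmul_zero]⟩
    | add x y hx hy =>
      obtain ⟨z, hz, hj⟩ := hx
      obtain ⟨w, hw, hk⟩ := hy
      exact ⟨z + w, by rw [map_add, map_add, hz, hw],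
        by rw [map_add, map_add, hj, hk, TensorProduct.tmul_add]⟩
    | tmul b c => exact ⟨_, inclRight₀_tmul b c, rfl⟩
  rw [hz, norm_of]
  refine (minSeminorm₃_le_jRight z).trans ?_
  rw [hj]
  refine (minSeminorm_tmul_le _ _).trans ?_
  rw [MinTensor.norm_of]
  have h1 : ‖(1 : A)‖ ≤ 1 := by
    cases subsingleton_or_nontrivial A
    · rw [Subsingleton.elim (1 : A) 0, norm_zero]; exact zero_le_one
    · rw [CStarRing.norm_one]
  calc _ ≤ 1 * minSeminorm B C y := mul_le_mul_of_nonneg_right h1 (CStarSeminorm.nonneg _ _)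
    _ = _ := one_mul _

/-- `t ↦ t ⊗ 1`, from the minimal tensor product of `A` and `B` to the threefold one. -/
def inclLeft : MinTensor A B →⋆ₐ[ℂ] MinTensor₃ A B C :=
  MinTensor.lift (inclLeft₀ A B C) norm_inclLeft₀_le

/-- `t ↦ 1 ⊗ t`, from the minimal tensor product of `B` and `C` to the threefold one. -/
def inclRight : MinTensor B C →⋆ₐ[ℂ] MinTensor₃ A B C :=
  MinTensor.lift (inclRight₀ A B C) norm_inclRight₀_le

theorem inclLeft_of (x : A ⊗[ℂ] B) :
    inclLeft (MinTensor.of A B x) = of A B C (x ⊗ₜ 1) := MinTensor.lift_of _ norm_inclLeft₀_le x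

theorem inclRight_of (b : B) (c : C) :
    inclRight (MinTensor.of B C (b ⊗ₜ c)) = of A B C ((1 ⊗ₜ b) ⊗ₜ c) :=
  (MinTensor.lift_of _ norm_inclRight₀_le (b ⊗ₜ c)).trans (inclRight₀_tmul b c)

theorem commute_left (t : MinTensor A B) (c : C) :
    Commute (inclLeft t : MinTensor₃ A B C) (inclLast A B C c) := by
  refine MinTensor.denseRange_of.induction_on t (isClosed_eq ?_ ?_) fun x => ?_
  · exact (MinTensor.hom_continuous inclLeft).mul continuous_const
  · exact continuous_const.mul (MinTensor.hom_continuous inclLeft)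
  · change _ * _ = _ * _
    rw [inclLeft_of, inclLast_apply, ← map_mul, ← map_mul, Algebra.TensorProduct.tmul_mul_tmul,
      Algebra.TensorProduct.tmul_mul_tmul, one_mul, mul_one, one_mul, mul_one]

theorem commute_right (a : A) (t : MinTensor B C) :
    Commute (inclFirst A B C a) (inclRight t : MinTensor₃ A B C) := by
  refine MinTensor.denseRange_of.induction_on t (isClosed_eq ?_ ?_) fun x => ?_
  · exact continuous_const.mul (MinTensor.hom_continuous inclRight)
  · exact (MinTensor.hom_continuous inclRight).mul continuous_const
  · induction x with
    | zero => rw [map_zero, map_zero]; exact Commute.zero_right _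
    | add x y hx hy => rw [map_add, map_add]; exact Commute.add_right hx hy
    | tmul b c =>
      change _ * _ = _ * _
      rw [inclRight_of, inclFirst_apply, ← map_mul, ← map_mul]
      simp only [Algebra.TensorProduct.tmul_mul_tmul, one_mul, mul_one]

/-- `t ⊗ c ↦ t ⊗ c` on the algebraic tensor product. -/
def assocLeft₀ : MinTensor A B ⊗[ℂ] C →⋆ₐ[ℂ] MinTensor₃ A B C :=
  starLift inclLeft (inclLast A B C) commute_left

/-- `a ⊗ t ↦ a ⊗ t` on the algebraic tensor product. -/
def assocRight₀ : A ⊗[ℂ] MinTensor B C →⋆ₐ[ℂ] MinTensor₃ A B C :=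
  starLift (inclFirst A B C) inclRight commute_right

theorem assocLeft₀_jLeft (z : (A ⊗[ℂ] B) ⊗[ℂ] C) : assocLeft₀ (jLeft z) = of A B C z := by
  induction z with
  | zero => simp only [map_zero]
  | add x y hx hy => simp only [map_add, hx, hy]
  | tmul x c =>
    rw [jLeft_tmul, assocLeft₀, starLift_tmul, inclLeft_of, inclLast_apply, ← map_mul,
      Algebra.TensorProduct.tmul_mul_tmul, one_mul, mul_one]

theorem assocRight₀_jRight (z : (A ⊗[ℂ] B) ⊗[ℂ] C) : assocRight₀ (jRight z) = of A B C z := by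
  induction z with
  | zero => simp only [map_zero]
  | add x y hx hy => simp only [map_add, hx, hy]
  | tmul x c =>
    induction x with
    | zero => simp only [TensorProduct.zero_tmul, map_zero]
    | add x y hx hy => simp only [TensorProduct.add_tmul, map_add, hx, hy]
    | tmul a b =>
      rw [jRight_tmul, assocRight₀, starLift_tmul, inclRight_of, inclFirst_apply, ← map_mul]
      simp only [Algebra.TensorProduct.tmul_mul_tmul, one_mul, mul_one]

theorem norm_hom_tmul_le {T S D : Type u} [CStarAlgebra T] [CStarAlgebra S] [CStarAlgebra D]
    (f : T →⋆ₐ[ℂ] D) (g : S →⋆ₐ[ℂ] D) (h : ∀ x y, Commute (f x) (g y)) (t : T) (s : S) :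
    ‖starLift f g h (t ⊗ₜ s)‖ ≤ ‖t‖ * ‖s‖ := by
  rw [starLift_tmul]
  exact (norm_mul_le _ _).trans (mul_le_mul (NonUnitalStarAlgHom.norm_apply_le f t)
    (NonUnitalStarAlgHom.norm_apply_le g s) (norm_nonneg _) (norm_nonneg _))

/-- A bound on the image of a subspace that approximates every elementary tensor. -/
theorem norm_le_of_approx {T S D V : Type u} [CStarAlgebra T] [CStarAlgebra S] [CStarAlgebra D]
    [AddCommGroup V] [Module ℂ V] (j : V →ₗ[ℂ] T ⊗[ℂ] S) (Φ : T ⊗[ℂ] S →⋆ₐ[ℂ] D)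
    (hj : ∀ z, ‖Φ (j z)‖ ≤ minSeminorm T S (j z))
    (hd : ∀ (t : T) (s : S) (ε : ℝ), 0 < ε → ∃ z, minSeminorm T S (t ⊗ₜ s - j z) ≤ ε ∧
      ‖Φ (t ⊗ₜ s - j z)‖ ≤ ε) (w : T ⊗[ℂ] S) : ‖Φ w‖ ≤ minSeminorm T S w := by
  have key : ∀ ε : ℝ, 0 < ε → ∃ z, minSeminorm T S (w - j z) ≤ ε ∧ ‖Φ (w - j z)‖ ≤ ε := by
    induction w with
    | zero => exact fun ε hε => ⟨0, by simp [hε.le], by simp [hε.le]⟩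
    | tmul t s => exact hd t s
    | add x y hx hy =>
      intro ε hε
      obtain ⟨z, hz, hz'⟩ := hx (ε / 2) (half_pos hε)
      obtain ⟨z₂, hz₂, hz₂'⟩ := hy (ε / 2) (half_pos hε)
      have e : x + y - j (z + z₂) = (x - j z) + (y - j z₂) := by rw [map_add]; abel
      refine ⟨z + z₂, ?_, ?_⟩
      · rw [e]
        exact (map_add_le_add (minSeminorm T S).toSeminorm _ _).trans (by linarith)
      · rw [e, map_add]
        exact (norm_add_le _ _).trans (by linarith)
  refine le_of_forall_pos_le_add fun ε hε => ?_
  obtain ⟨z, hz, hz'⟩ := key (ε / 2) (half_pos hε)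
  have h1 : ‖Φ w‖ ≤ ‖Φ (j z)‖ + ‖Φ (w - j z)‖ := by
    have : Φ w = Φ (j z) + Φ (w - j z) := by rw [← map_add]; congr 1; abel
    rw [this]; exact norm_add_le _ _
  have h2 : minSeminorm T S (j z) ≤ minSeminorm T S w + minSeminorm T S (w - j z) := by
    have : j z = w - (w - j z) := by abel
    calc _ = minSeminorm T S (w - (w - j z)) := by rw [← this]
      _ ≤ _ := map_sub_le_add (minSeminorm T S).toSeminorm _ _
  linarith [hj z]

theorem norm_assocLeft₀_le (w : MinTensor A B ⊗[ℂ] C) :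
    ‖assocLeft₀ w‖ ≤ minSeminorm (MinTensor A B) C w := by
  refine norm_le_of_approx jLeft assocLeft₀ (fun z => ?_) (fun t c ε hε => ?_) w
  · rw [assocLeft₀_jLeft, norm_of]; exact minSeminorm₃_le_jLeft z
  · obtain ⟨x, hx⟩ := MinTensor.denseRange_of.exists_dist_lt t
      (show 0 < ε / (‖c‖ + 1) from div_pos hε (by positivity))
    have e : t ⊗ₜ[ℂ] c - jLeft (x ⊗ₜ c) = (t - MinTensor.of A B x) ⊗ₜ c := by
      rw [jLeft_tmul, TensorProduct.sub_tmul]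
    have hb : ‖t - MinTensor.of A B x‖ * ‖c‖ ≤ ε := by
      rw [dist_eq_norm, lt_div_iff₀ (by positivity)] at hx
      nlinarith [norm_nonneg (t - MinTensor.of A B x)]
    refine ⟨x ⊗ₜ c, ?_, ?_⟩
    · rw [e]; exact (minSeminorm_tmul_le _ _).trans hb
    · rw [e]; exact (norm_hom_tmul_le _ _ _ _ _).trans hb

theorem norm_assocRight₀_le (w : A ⊗[ℂ] MinTensor B C) :
    ‖assocRight₀ w‖ ≤ minSeminorm A (MinTensor B C) w := by
  refine norm_le_of_approx jRight assocRight₀ (fun z => ?_) (fun a t ε hε => ?_) w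
  · rw [assocRight₀_jRight, norm_of]; exact minSeminorm₃_le_jRight z
  · obtain ⟨x, hx⟩ := MinTensor.denseRange_of.exists_dist_lt t
      (show 0 < ε / (‖a‖ + 1) from div_pos hε (by positivity))
    have e : a ⊗ₜ[ℂ] t - jRight ((TensorProduct.assoc ℂ A B C).symm (a ⊗ₜ x)) =
        a ⊗ₜ (t - MinTensor.of B C x) := by
      rw [TensorProduct.tmul_sub]
      congr 1
      change TensorProduct.map _ _ (TensorProduct.assoc ℂ A B C
        ((TensorProduct.assoc ℂ A B C).symm (a ⊗ₜ x))) = _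
      rw [LinearEquiv.apply_symm_apply]
      rfl
    have hb : ‖a‖ * ‖t - MinTensor.of B C x‖ ≤ ε := by
      rw [dist_eq_norm, lt_div_iff₀ (by positivity)] at hx
      nlinarith [norm_nonneg (t - MinTensor.of B C x)]
    refine ⟨(TensorProduct.assoc ℂ A B C).symm (a ⊗ₜ x), ?_, ?_⟩
    · rw [e]; exact (minSeminorm_tmul_le _ _).trans hb
    · rw [e]; exact (norm_hom_tmul_le _ _ _ _ _).trans hb

variable (A B C)

/-- The canonical identification of `(A ⊗ B) ⊗ C` with `A ⊗ B ⊗ C`. -/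
def assocLeft : MinTensor (MinTensor A B) C →⋆ₐ[ℂ] MinTensor₃ A B C :=
  MinTensor.lift assocLeft₀ norm_assocLeft₀_le

/-- The canonical identification of `A ⊗ (B ⊗ C)` with `A ⊗ B ⊗ C`. -/
def assocRight : MinTensor A (MinTensor B C) →⋆ₐ[ℂ] MinTensor₃ A B C :=
  MinTensor.lift assocRight₀ norm_assocRight₀_le

variable {A B C}

theorem assocLeft_tmul (a : A) (b : B) (c : C) :
    assocLeft A B C (MinTensor.tmul (MinTensor.tmul a b) c) = of A B C ((a ⊗ₜ b) ⊗ₜ c) :=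
  (MinTensor.lift_of assocLeft₀ norm_assocLeft₀_le _).trans (assocLeft₀_jLeft ((a ⊗ₜ b) ⊗ₜ c))

theorem assocRight_tmul (a : A) (b : B) (c : C) :
    assocRight A B C (MinTensor.tmul a (MinTensor.tmul b c)) = of A B C ((a ⊗ₜ b) ⊗ₜ c) :=
  (MinTensor.lift_of assocRight₀ norm_assocRight₀_le _).trans (assocRight₀_jRight ((a ⊗ₜ b) ⊗ₜ c))

end MinTensor₃

end Assoc

namespace MinTensor

variable {A B C D A' B' C' : Type u} [CStarAlgebra A] [CStarAlgebra B] [CStarAlgebra C]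
  [CStarAlgebra D] [CStarAlgebra A'] [CStarAlgebra B'] [CStarAlgebra C']

/-- `a ↦ a ⊗ 1`. -/
def inl (A B : Type u) [CStarAlgebra A] [CStarAlgebra B] : A →⋆ₐ[ℂ] MinTensor A B :=
  (of A B).comp
    { (Algebra.TensorProduct.includeLeft : A →ₐ[ℂ] A ⊗[ℂ] B) with
      map_star' := fun x => by
        change star x ⊗ₜ[ℂ] (1 : B) = star (x ⊗ₜ[ℂ] (1 : B))
        rw [TensorProduct.star_tmul, star_one] }

/-- `b ↦ 1 ⊗ b`. -/
def inr (A B : Type u) [CStarAlgebra A] [CStarAlgebra B] : B →⋆ₐ[ℂ] MinTensor A B :=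
  (of A B).comp
    { (Algebra.TensorProduct.includeRight : B →ₐ[ℂ] A ⊗[ℂ] B) with
      map_star' := fun x => by
        change (1 : A) ⊗ₜ[ℂ] star x = star ((1 : A) ⊗ₜ[ℂ] x)
        rw [TensorProduct.star_tmul, star_one] }

theorem inl_apply (a : A) : inl A B a = tmul a 1 := rfl

theorem inr_apply (b : B) : inr A B b = tmul 1 b := rfl

theorem tmul_mul_tmul (a a' : A) (b b' : B) :
    tmul a b * tmul a' b' = tmul (a * a') (b * b') := by
  rw [tmul, tmul, ← map_mul, Algebra.TensorProduct.tmul_mul_tmul, tmul]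

theorem hom_ext_incl {f g : MinTensor A B →⋆ₐ[ℂ] D} (h₁ : f.comp (inl A B) = g.comp (inl A B))
    (h₂ : f.comp (inr A B) = g.comp (inr A B)) : f = g :=
  hom_ext fun a b => by
    have e : (tmul a b : MinTensor A B) = inl A B a * inr A B b := by
      rw [inl_apply, inr_apply, tmul_mul_tmul, one_mul, mul_one]
    rw [e, map_mul, map_mul]
    exact congrArg₂ _ (DFunLike.congr_fun h₁ a) (DFunLike.congr_fun h₂ b)

theorem hom_ext_left {f g : MinTensor (MinTensor A B) C →⋆ₐ[ℂ] D}
    (h : ∀ a b c, f (tmul (tmul a b) c) = g (tmul (tmul a b) c)) : f = g := by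
  have one : (1 : MinTensor A B) = tmul 1 1 := (map_one (of A B)).symm
  refine hom_ext_incl (hom_ext fun a b => h a b 1) (StarAlgHom.ext fun c => ?_)
  change f (tmul 1 c) = g (tmul 1 c)
  rw [one]; exact h 1 1 c

theorem hom_ext_right {f g : MinTensor A (MinTensor B C) →⋆ₐ[ℂ] D}
    (h : ∀ a b c, f (tmul a (tmul b c)) = g (tmul a (tmul b c))) : f = g := by
  have one : (1 : MinTensor B C) = tmul 1 1 := (map_one (of B C)).symm
  refine hom_ext_incl (StarAlgHom.ext fun a => ?_) (hom_ext fun b c => h 1 b c)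
  change f (tmul a 1) = g (tmul a 1)
  rw [one]; exact h a 1 1

theorem map_id (A B : Type u) [CStarAlgebra A] [CStarAlgebra B] :
    map (StarAlgHom.id ℂ A) (StarAlgHom.id ℂ B) = StarAlgHom.id ℂ (MinTensor A B) :=
  hom_ext fun _ _ => map_tmul ..

end MinTensor

namespace MinTensor₃

variable {A B C A' B' C' : Type u} [CStarAlgebra A] [CStarAlgebra B] [CStarAlgebra C]
  [CStarAlgebra A'] [CStarAlgebra B'] [CStarAlgebra C']

theorem map_comp_assocLeft (φ : A →⋆ₐ[ℂ] A') (ψ : B →⋆ₐ[ℂ] B') (χ : C →⋆ₐ[ℂ] C') :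
    (map φ ψ χ).comp (assocLeft A B C) =
      (assocLeft A' B' C').comp (MinTensor.map (MinTensor.map φ ψ) χ) :=
  MinTensor.hom_ext_left fun a b c => by
    simp only [StarAlgHom.comp_apply, assocLeft_tmul, MinTensor.map_tmul, map_of, starMap_tmul]

theorem map_comp_assocRight (φ : A →⋆ₐ[ℂ] A') (ψ : B →⋆ₐ[ℂ] B') (χ : C →⋆ₐ[ℂ] C') :
    (map φ ψ χ).comp (assocRight A B C) =
      (assocRight A' B' C').comp (MinTensor.map φ (MinTensor.map ψ χ)) :=
  MinTensor.hom_ext_right fun a b c => by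
    simp only [StarAlgHom.comp_apply, assocRight_tmul, MinTensor.map_tmul, map_of, starMap_tmul]

end MinTensor₃

/-! ### C⋆-compact quantum groups -/

/-- A C⋆-compact quantum group: a unital C⋆-algebra `A` with a coassociative unital
⋆-homomorphism `Δ : A → A ⊗ A` such that the linear spans of `Δ(A)(A ⊗ 1)` and `Δ(A)(1 ⊗ A)` are
dense in `A ⊗ A`. -/
structure IsCompactQuantumGroup {A : Type u} [CStarAlgebra A] (Δ : A →⋆ₐ[ℂ] MinTensor A A) :
    Prop where
  coassoc : (MinTensor₃.assocLeft A A A).comp ((MinTensor.map Δ (StarAlgHom.id ℂ A)).comp Δ) =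
    (MinTensor₃.assocRight A A A).comp ((MinTensor.map (StarAlgHom.id ℂ A) Δ).comp Δ)
  dense_left : Dense (Submodule.span ℂ
    {x : MinTensor A A | ∃ a b, x = Δ a * MinTensor.tmul b 1} : Set (MinTensor A A))
  dense_right : Dense (Submodule.span ℂ
    {x : MinTensor A A | ∃ a b, x = Δ a * MinTensor.tmul 1 b} : Set (MinTensor A A))

/-! ### Inverse systems and σ-C⋆-algebras -/

/-- An inverse system `A₀ ← A₁ ← A₂ ← ⋯` of unital C⋆-algebras and unital ⋆-homomorphisms. -/
structure CStarSystem : Type (u + 1) where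
  obj : ℕ → Type u
  [cstarAlgebra : ∀ n, CStarAlgebra (obj n)]
  map : ∀ n, obj (n + 1) →⋆ₐ[ℂ] obj n

attribute [instance] CStarSystem.cstarAlgebra

namespace CStarSystem

/-- All connecting maps are surjective. -/
def IsSurjective (S : CStarSystem.{u}) : Prop := ∀ n, Function.Surjective (S.map n)

/-- The inverse limit in the category of topological ⋆-algebras: the ⋆-algebra of coherent
sequences, with the topology induced from the product of the norm topologies. -/
def Lim (S : CStarSystem.{u}) : StarSubalgebra ℂ (∀ n, S.obj n) where
  carrier := {x | ∀ n, S.map n (x (n + 1)) = x n}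
  mul_mem' hx hy n := by simp only [Pi.mul_apply, map_mul, hx n, hy n]
  add_mem' hx hy n := by simp only [Pi.add_apply, map_add, hx n, hy n]
  algebraMap_mem' r n := AlgHomClass.commutes (S.map n) r
  star_mem' hx n := by simp only [Pi.star_apply, map_star, hx n]

/-- The canonical projection from the inverse limit. -/
def proj (S : CStarSystem.{u}) (n : ℕ) : S.Lim →⋆ₐ[ℂ] S.obj n where
  toFun x := x.1 n
  map_one' := rfl
  map_mul' _ _ := rfl
  map_zero' := rfl
  map_add' _ _ := rfl
  commutes' _ := rfl
  map_star' _ := rfl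

theorem map_proj (S : CStarSystem.{u}) (n : ℕ) (x : S.Lim) :
    S.map n (S.proj (n + 1) x) = S.proj n x := x.2 n

theorem lim_ext {S : CStarSystem.{u}} {x y : S.Lim} (h : ∀ n, S.proj n x = S.proj n y) : x = y :=
  Subtype.ext (funext h)

theorem continuous_proj (S : CStarSystem.{u}) (n : ℕ) : Continuous (S.proj n) :=
  (continuous_apply n).comp continuous_subtype_val

theorem proj_surjective {S : CStarSystem.{u}} (hS : S.IsSurjective) (n : ℕ) :
    Function.Surjective (S.proj n) := by
  intro a
  obtain ⟨x, hx, hxa⟩ : ∃ x : ∀ k, S.obj k, (∀ k < n, S.map k (x (k + 1)) = x k) ∧ x n = a := by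
    induction n with
    | zero => exact ⟨Function.update 0 0 a, by simp, by simp⟩
    | succ n ih =>
      obtain ⟨x, hx, hxa⟩ := ih (S.map n a)
      refine ⟨Function.update x (n + 1) a, fun k hk => ?_, by simp⟩
      rw [Function.update_of_ne (show k ≠ n + 1 by omega)]
      rcases Nat.lt_succ_iff_lt_or_eq.mp hk with h | rfl
      · rw [Function.update_of_ne (show k + 1 ≠ n + 1 by omega), hx k h]
      · rw [Function.update_self, hxa]
  let z : ∀ k, S.obj k := fun k => Nat.rec (motive := fun k => S.obj k) (x 0)
    (fun k y => if k + 1 ≤ n then x (k + 1) else Function.surjInv (hS k) y) k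
  have hz : ∀ k, z (k + 1) = if k + 1 ≤ n then x (k + 1) else Function.surjInv (hS k) (z k) :=
    fun k => rfl
  have hzx : ∀ k ≤ n, z k = x k := by
    intro k hk
    cases k with
    | zero => rfl
    | succ k => rw [hz, if_pos hk]
  refine ⟨⟨z, fun k => ?_⟩, (hzx n le_rfl).trans hxa⟩
  rw [hz]
  split_ifs with h
  · rw [hx k h, hzx k (by omega)]
  · exact Function.surjInv_eq (hS k) (z k)

/-- A morphism of inverse systems. -/
structure Hom (S T : CStarSystem.{u}) where
  app : ∀ n, S.obj n →⋆ₐ[ℂ] T.obj n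
  naturality : ∀ n, (T.map n).comp (app (n + 1)) = (app n).comp (S.map n)

/-- The universal property of the inverse limit: a coherent family of ⋆-homomorphisms into the
`T_n` gives a ⋆-homomorphism into the limit. -/
def limLift {T : CStarSystem.{u}} {D : Type v} [Semiring D] [Algebra ℂ D] [Star D]
    (f : ∀ n, D →⋆ₐ[ℂ] T.obj n) (hf : ∀ n x, T.map n (f (n + 1) x) = f n x) :
    D →⋆ₐ[ℂ] T.Lim where
  toFun x := ⟨fun n => f n x, fun n => hf n x⟩
  map_one' := Subtype.ext (funext fun n => by simp only [map_one]; rfl)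
  map_mul' x y := Subtype.ext (funext fun n => by simp only [map_mul]; rfl)
  map_zero' := Subtype.ext (funext fun n => by simp only [map_zero]; rfl)
  map_add' x y := Subtype.ext (funext fun n => by simp only [map_add]; rfl)
  commutes' r := Subtype.ext (funext fun n => AlgHomClass.commutes (f n) r)
  map_star' x := Subtype.ext (funext fun n => by simp only [map_star]; rfl)

/-- The ⋆-homomorphism of inverse limits induced by a morphism of inverse systems. -/
def Hom.lim {S T : CStarSystem.{u}} (f : Hom S T) : S.Lim →⋆ₐ[ℂ] T.Lim :=
  limLift (fun n => (f.app n).comp (S.proj n)) fun n x =>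
    (DFunLike.congr_fun (f.naturality n) (S.proj (n + 1) x)).trans
      (congrArg (f.app n) (S.map_proj n x))

theorem Hom.proj_lim {S T : CStarSystem.{u}} (f : Hom S T) (n : ℕ) (x : S.Lim) :
    T.proj n (f.lim x) = f.app n (S.proj n x) := rfl

/-- The tensor product system `Aₙ ⊗ Bₙ`; its limit is the minimal tensor product of the
limits. -/
abbrev tensor (S T : CStarSystem.{u}) : CStarSystem.{u} where
  obj n := MinTensor (S.obj n) (T.obj n)
  map n := MinTensor.map (S.map n) (T.map n)

/-- The threefold tensor product system `Aₙ ⊗ Bₙ ⊗ Cₙ`. -/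
abbrev tensor₃ (S T U : CStarSystem.{u}) : CStarSystem.{u} where
  obj n := MinTensor₃ (S.obj n) (T.obj n) (U.obj n)
  map n := MinTensor₃.map (S.map n) (T.map n) (U.map n)

/-- The elementary tensor `x ⊗ y` of elements of inverse limits. -/
def tmul {S T : CStarSystem.{u}} (x : S.Lim) (y : T.Lim) : (S.tensor T).Lim :=
  ⟨fun n => MinTensor.tmul (S.proj n x) (T.proj n y), fun n =>
    (MinTensor.map_tmul ..).trans (congrArg₂ _ (S.map_proj n x) (T.map_proj n y))⟩

/-- The canonical identification of `(A ⊗ B) ⊗ C` with `A ⊗ B ⊗ C`. -/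
def assocLeft (S T U : CStarSystem.{u}) : Hom ((S.tensor T).tensor U) (S.tensor₃ T U) where
  app n := MinTensor₃.assocLeft (S.obj n) (T.obj n) (U.obj n)
  naturality n := MinTensor₃.map_comp_assocLeft (S.map n) (T.map n) (U.map n)

/-- The canonical identification of `A ⊗ (B ⊗ C)` with `A ⊗ B ⊗ C`. -/
def assocRight (S T U : CStarSystem.{u}) : Hom (S.tensor (T.tensor U)) (S.tensor₃ T U) where
  app n := MinTensor₃.assocRight (S.obj n) (T.obj n) (U.obj n)
  naturality n := MinTensor₃.map_comp_assocRight (S.map n) (T.map n) (U.map n)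

/-! ### Tensor products of continuous ⋆-homomorphisms between inverse limits -/

/-- The `n`-th component of `φ` factors through the projection to level `m`. -/
def Factors {S S' : CStarSystem.{u}} (φ : S.Lim →⋆ₐ[ℂ] S'.Lim) (n m : ℕ) : Prop :=
  ∀ x, S.proj m x = 0 → S'.proj n (φ x) = 0

theorem proj_eq_zero_of_le {S : CStarSystem.{u}} {m k : ℕ} (h : m ≤ k) {x : S.Lim}
    (hx : S.proj k x = 0) : S.proj m x = 0 := by
  induction k, h using Nat.le_induction with
  | base => exact hx
  | succ k _ ih => exact ih (by rw [← S.map_proj, hx, map_zero])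

theorem Factors.mono {S S' : CStarSystem.{u}} {φ : S.Lim →⋆ₐ[ℂ] S'.Lim} {n m k : ℕ}
    (h : Factors φ n m) (hmk : m ≤ k) : Factors φ n k :=
  fun x hx => h x (proj_eq_zero_of_le hmk hx)

theorem exists_factors {S S' : CStarSystem.{u}} (φ : S.Lim →⋆ₐ[ℂ] S'.Lim) (hφ : Continuous φ)
    (n : ℕ) : ∃ m, Factors φ n m := by
  have h1 : {x : S.Lim | ‖S'.proj n (φ x)‖ < 1} ∈ nhds (0 : S.Lim) := by
    refine (isOpen_lt ((S'.continuous_proj n).comp hφ).norm continuous_const).mem_nhds ?_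
    simp
  obtain ⟨V, hV, hVsub⟩ := mem_nhds_induced _ _ _ |>.mp h1
  rw [ZeroMemClass.coe_zero, nhds_pi, Filter.mem_pi] at hV
  obtain ⟨I, hI, t, ht, htV⟩ := hV
  obtain ⟨m, hm⟩ := hI.bddAbove
  refine ⟨m, fun x hx => ?_⟩
  have key : ∀ c : ℂ, ‖S'.proj n (φ (c • x))‖ < 1 := fun c => by
    refine hVsub (htV fun i hi => ?_)
    have h0 : S.proj i (c • x) = 0 := by
      rw [map_smul, proj_eq_zero_of_le (hm hi) hx, smul_zero]
    change S.proj i (c • x) ∈ t i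
    rw [h0]
    exact mem_of_mem_nhds (ht i)
  by_contra hne
  have hpos : 0 < ‖S'.proj n (φ x)‖ := norm_pos_iff.mpr hne
  have := key ((‖S'.proj n (φ x)‖⁻¹ : ℝ) : ℂ)
  rw [map_smul, map_smul, norm_smul, Complex.norm_real, norm_inv, norm_norm,
    inv_mul_cancel₀ hpos.ne'] at this
  exact lt_irrefl _ this

theorem factors_eq {S S' : CStarSystem.{u}} {φ : S.Lim →⋆ₐ[ℂ] S'.Lim} {n m : ℕ}
    (h : Factors φ n m) {x y : S.Lim} (hxy : S.proj m x = S.proj m y) :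
    S'.proj n (φ x) = S'.proj n (φ y) := by
  rw [← sub_eq_zero, ← map_sub, ← map_sub]
  exact h _ (by rw [map_sub, hxy, sub_self])

/-- The ⋆-homomorphism `S_m → S'_n` through which the `n`-th component of `φ` factors. -/
def levelMap {S S' : CStarSystem.{u}} (hS : S.IsSurjective) (φ : S.Lim →⋆ₐ[ℂ] S'.Lim) {n m : ℕ}
    (h : Factors φ n m) : S.obj m →⋆ₐ[ℂ] S'.obj n :=
  have hi : ∀ a, S.proj m (Function.surjInv (proj_surjective hS m) a) = a :=
    Function.surjInv_eq (proj_surjective hS m)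
  { toFun := fun a => S'.proj n (φ (Function.surjInv (proj_surjective hS m) a))
    map_one' := by
      rw [factors_eq h (y := 1) (by rw [hi, map_one]), map_one, map_one]
    map_mul' := fun a b => by
      rw [← map_mul, ← map_mul]
      exact factors_eq h (by rw [hi, map_mul, hi, hi])
    map_zero' := by
      rw [factors_eq h (y := 0) (by rw [hi, map_zero]), map_zero, map_zero]
    map_add' := fun a b => by
      rw [← map_add, ← map_add]
      exact factors_eq h (by rw [hi, map_add, hi, hi])
    commutes' := fun r => by
      rw [factors_eq h (y := algebraMap ℂ _ r) (by rw [hi, AlgHomClass.commutes]),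
        AlgHomClass.commutes, AlgHomClass.commutes]
    map_star' := fun a => by
      rw [← map_star, ← map_star]
      exact factors_eq h (by rw [hi, map_star, hi]) }

theorem levelMap_proj {S S' : CStarSystem.{u}} (hS : S.IsSurjective) (φ : S.Lim →⋆ₐ[ℂ] S'.Lim)
    {n m : ℕ} (h : Factors φ n m) (x : S.Lim) :
    levelMap hS φ h (S.proj m x) = S'.proj n (φ x) :=
  factors_eq h (Function.surjInv_eq (proj_surjective hS m) _)

theorem hom_ext_proj {S : CStarSystem.{u}} (hS : S.IsSurjective) {m : ℕ} {D : Type u}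
    [CStarAlgebra D] {f g : S.obj m →⋆ₐ[ℂ] D} (h : ∀ x, f (S.proj m x) = g (S.proj m x)) :
    f = g :=
  StarAlgHom.ext fun a => by
    obtain ⟨x, rfl⟩ := proj_surjective hS m a
    exact h x

section TensorMap

variable {S T S' T' : CStarSystem.{u}} (hS : S.IsSurjective) (hT : T.IsSurjective)
  (φ : S.Lim →⋆ₐ[ℂ] S'.Lim) (ψ : T.Lim →⋆ₐ[ℂ] T'.Lim)

theorem levelMap_tensor_le {n m k : ℕ} (hmk : m ≤ k) (hm : Factors φ n m) (hm' : Factors ψ n m)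
    (hk : Factors φ n k) (hk' : Factors ψ n k) (t : (S.tensor T).Lim) :
    MinTensor.map (levelMap hS φ hk) (levelMap hT ψ hk') ((S.tensor T).proj k t) =
      MinTensor.map (levelMap hS φ hm) (levelMap hT ψ hm') ((S.tensor T).proj m t) := by
  induction k, hmk using Nat.le_induction with
  | base => rfl
  | succ k hmk ih =>
    rw [← ih (hm.mono hmk) (hm'.mono hmk), ← (S.tensor T).map_proj k t]
    have e₁ : levelMap hS φ hk = (levelMap hS φ (hm.mono hmk)).comp (S.map k) :=
      hom_ext_proj hS fun x => by
        rw [StarAlgHom.comp_apply, S.map_proj, levelMap_proj, levelMap_proj]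
    have e₂ : levelMap hT ψ hk' = (levelMap hT ψ (hm'.mono hmk)).comp (T.map k) :=
      hom_ext_proj hT fun x => by
        rw [StarAlgHom.comp_apply, T.map_proj, levelMap_proj, levelMap_proj]
    rw [e₁, e₂, ← MinTensor.map_comp_map]
    rfl

theorem levelMap_tensor_eq {n m k : ℕ} (hm : Factors φ n m) (hm' : Factors ψ n m)
    (hk : Factors φ n k) (hk' : Factors ψ n k) (t : (S.tensor T).Lim) :
    MinTensor.map (levelMap hS φ hk) (levelMap hT ψ hk') ((S.tensor T).proj k t) =
      MinTensor.map (levelMap hS φ hm) (levelMap hT ψ hm') ((S.tensor T).proj m t) := by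
  rcases le_total m k with h | h
  · exact levelMap_tensor_le hS hT φ ψ h hm hm' hk hk' t
  · exact (levelMap_tensor_le hS hT φ ψ h hk hk' hm hm' t).symm

theorem exists_factors_both {φ : S.Lim →⋆ₐ[ℂ] S'.Lim} (hφ : Continuous φ)
    {ψ : T.Lim →⋆ₐ[ℂ] T'.Lim} (hψ : Continuous ψ) (n : ℕ) : ∃ m, Factors φ n m ∧ Factors ψ n m := by
  obtain ⟨m, hm⟩ := exists_factors φ hφ n
  obtain ⟨k, hk⟩ := exists_factors ψ hψ n
  exact ⟨max m k, hm.mono (le_max_left _ _), hk.mono (le_max_right _ _)⟩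

theorem levelMap_compat {φ : S.Lim →⋆ₐ[ℂ] S'.Lim} {n m : ℕ} (h : Factors φ (n + 1) m) :
    Factors φ n m := fun x hx => by rw [← S'.map_proj, h x hx, map_zero]

/-- The tensor product `φ ⊗ ψ` of continuous unital ⋆-homomorphisms of inverse limits. Its `n`-th
component is `φ_{m,n} ⊗ ψ_{m,n}` on level `m`, where `m` is so large that the `n`-th components of
`φ` and `ψ` factor as `φ_{m,n}` and `ψ_{m,n}` through level `m`. -/
def tensorMap (hφ : Continuous φ) (hψ : Continuous ψ) :
    (S.tensor T).Lim →⋆ₐ[ℂ] (S'.tensor T').Lim :=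
  limLift
    (fun n => (MinTensor.map
        (levelMap hS φ (exists_factors_both hφ hψ n).choose_spec.1)
        (levelMap hT ψ (exists_factors_both hφ hψ n).choose_spec.2)).comp
      ((S.tensor T).proj (exists_factors_both hφ hψ n).choose))
    (fun n t => by
      have h := (exists_factors_both hφ hψ (n + 1)).choose_spec
      refine Eq.trans ?_ (levelMap_tensor_eq hS hT φ ψ _ _
        (levelMap_compat h.1) (levelMap_compat h.2) t)
      have e₁ : levelMap hS φ (levelMap_compat h.1) = (S'.map n).comp (levelMap hS φ h.1) :=
        hom_ext_proj hS fun x => by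
          rw [StarAlgHom.comp_apply, levelMap_proj, levelMap_proj, S'.map_proj]
      have e₂ : levelMap hT ψ (levelMap_compat h.2) = (T'.map n).comp (levelMap hT ψ h.2) :=
        hom_ext_proj hT fun x => by
          rw [StarAlgHom.comp_apply, levelMap_proj, levelMap_proj, T'.map_proj]
      rw [e₁, e₂, ← MinTensor.map_comp_map]
      rfl)

theorem proj_tensorMap (hφ : Continuous φ) (hψ : Continuous ψ) {n m : ℕ} (hm : Factors φ n m)
    (hm' : Factors ψ n m) (t : (S.tensor T).Lim) :
    (S'.tensor T').proj n (tensorMap hS hT φ ψ hφ hψ t) =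
      MinTensor.map (levelMap hS φ hm) (levelMap hT ψ hm') ((S.tensor T).proj m t) :=
  levelMap_tensor_eq hS hT φ ψ hm hm' _ _ t

theorem tensorMap_tmul (hφ : Continuous φ) (hψ : Continuous ψ) (x : S.Lim) (y : T.Lim) :
    tensorMap hS hT φ ψ hφ hψ (tmul x y) = tmul (φ x) (ψ y) :=
  lim_ext fun n => by
    have h := (exists_factors_both hφ hψ n).choose_spec
    refine (MinTensor.map_tmul (levelMap hS φ h.1) (levelMap hT ψ h.2) _ _).trans ?_
    rw [levelMap_proj, levelMap_proj]
    rfl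

end TensorMap

/-- The constant inverse system. -/
abbrev const (A : Type u) [CStarAlgebra A] : CStarSystem.{u} where
  obj _ := A
  map _ := StarAlgHom.id ℂ A

end CStarSystem

open CStarSystem

/-- A presentation of a topological unital ⋆-algebra `A` as a σ-C⋆-algebra: an isomorphism of
topological ⋆-algebras of `A` with the limit of an inverse sequence of C⋆-algebras with surjective
connecting maps. -/
structure SigmaCStarPresentation (A : Type u) [Ring A] [StarRing A] [Algebra ℂ A]
    [TopologicalSpace A] : Type (u + 1) where
  sys : CStarSystem.{u}
  surjective : sys.IsSurjective
  equiv : A ≃⋆ₐ[ℂ] sys.Lim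
  continuous_equiv : Continuous equiv
  continuous_symm : Continuous equiv.symm

namespace SigmaCStarPresentation

variable {A : Type u} [Ring A] [StarRing A] [Algebra ℂ A] [TopologicalSpace A]
  (P : SigmaCStarPresentation A)

/-- The minimal tensor product `A ⊗ A = lim Aₙ ⊗ Aₙ`. -/
abbrev Square : Type u := (P.sys.tensor P.sys).Lim

/-- The threefold minimal tensor product `A ⊗ A ⊗ A = lim Aₙ ⊗ Aₙ ⊗ Aₙ`. -/
abbrev Cube : Type u := (P.sys.tensor₃ P.sys P.sys).Lim

/-- The elementary tensor `a ⊗ b`. -/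
def tmul (a b : A) : P.Square := CStarSystem.tmul (P.equiv a) (P.equiv b)

/-- A ⋆-homomorphism out of `A`, regarded as one out of the presenting limit. -/
def toLim {T : CStarSystem.{u}} (f : A →⋆ₐ[ℂ] T.Lim) : P.sys.Lim →⋆ₐ[ℂ] T.Lim :=
  f.comp (P.equiv.symm : P.sys.Lim →⋆ₐ[ℂ] A)

theorem continuous_toLim {T : CStarSystem.{u}} {f : A →⋆ₐ[ℂ] T.Lim} (hf : Continuous f) :
    Continuous (P.toLim f) := hf.comp P.continuous_symm

/-- `Δ ⊗ id : A ⊗ A → A ⊗ A ⊗ A`. -/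
def comulTensorId (Δ : A →⋆ₐ[ℂ] P.Square) (hΔ : Continuous Δ) : P.Square →⋆ₐ[ℂ] P.Cube :=
  (assocLeft P.sys P.sys P.sys).lim.comp
    (tensorMap P.surjective P.surjective (P.toLim Δ) (StarAlgHom.id ℂ P.sys.Lim)
      (P.continuous_toLim hΔ) continuous_id)

/-- `id ⊗ Δ : A ⊗ A → A ⊗ A ⊗ A`. -/
def idTensorComul (Δ : A →⋆ₐ[ℂ] P.Square) (hΔ : Continuous Δ) : P.Square →⋆ₐ[ℂ] P.Cube :=
  (assocRight P.sys P.sys P.sys).lim.comp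
    (tensorMap P.surjective P.surjective (StarAlgHom.id ℂ P.sys.Lim) (P.toLim Δ)
      continuous_id (P.continuous_toLim hΔ))

/-- The limit of an inverse system with surjective connecting maps, with its tautological
presentation. -/
abbrev ofSystem (S : CStarSystem.{u}) (hS : S.IsSurjective) : SigmaCStarPresentation S.Lim where
  sys := S
  surjective := hS
  equiv := StarAlgEquiv.refl ℂ S.Lim
  continuous_equiv := continuous_id
  continuous_symm := continuous_id

/-- A C⋆-algebra, presented as the limit of the constant inverse system. -/
abbrev ofCStarAlgebra (A : Type u) [CStarAlgebra A] : SigmaCStarPresentation A where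
  sys := CStarSystem.const A
  surjective := fun _ a => ⟨a, rfl⟩
  equiv := StarAlgEquiv.ofStarAlgHom
    (limLift (T := CStarSystem.const A) (fun _ => StarAlgHom.id ℂ A) fun _ _ => rfl)
    ((CStarSystem.const A).proj 0)
    rfl
    (StarAlgHom.ext fun x => lim_ext fun n => by
      induction n with
      | zero => rfl
      | succ n ih => exact ih.trans (x.2 n).symm)
  continuous_equiv := Continuous.subtype_mk (continuous_pi fun _ => continuous_id) _
  continuous_symm := (CStarSystem.const A).continuous_proj 0

end SigmaCStarPresentation

/-- `(A, Δ)` is a σ-C⋆-quantum group: `Δ : A → A ⊗ A` is a (continuous) unital ⋆-homomorphism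
which is coassociative and such that the linear spans of `Δ(A)(A ⊗ 1)` and `Δ(A)(1 ⊗ A)` are dense
in `A ⊗ A`. -/
structure IsSigmaCStarQuantumGroup {A : Type u} [Ring A] [StarRing A] [Algebra ℂ A]
    [TopologicalSpace A] (P : SigmaCStarPresentation A) (Δ : A →⋆ₐ[ℂ] P.Square) : Prop where
  continuous : Continuous Δ
  coassoc : (P.comulTensorId Δ continuous).comp Δ = (P.idTensorComul Δ continuous).comp Δ
  dense_left : Dense (Submodule.span ℂ
    {x : P.Square | ∃ a b, x = Δ a * P.tmul b 1} : Set P.Square)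
  dense_right : Dense (Submodule.span ℂ
    {x : P.Square | ∃ a b, x = Δ a * P.tmul 1 b} : Set P.Square)

/-- The comultiplication of a C⋆-algebra, with values in the limit of the constant system
`A ⊗ A`. -/
def constComul {A : Type u} [CStarAlgebra A] (Δ : A →⋆ₐ[ℂ] MinTensor A A) :
    A →⋆ₐ[ℂ] (SigmaCStarPresentation.ofCStarAlgebra A).Square :=
  limLift (T := (CStarSystem.const A).tensor (CStarSystem.const A)) (fun _ => Δ) fun _ a =>
    DFunLike.congr_fun (MinTensor.map_id A A) (Δ a)

end SigmaCStar

end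

namespace SigmaCStar

/-! ### Inverse limits tested one level at a time -/

namespace CStarSystem

/-! Each condition in the definition can be checked one level at a time. This works because the
limit carries the topology induced from the product of the norm topologies, and because the double
and triple tensor products of `A` are themselves limits of the tensor products of the levels. The
comultiplication `D` has `n`-th component `Δ n` applied to the `n`-th coordinate, so each level only
has to supply the same property of a compact quantum group. `IsSigmaCStarQuantumGroup.of_levels`
carries this out for an arbitrary presentation. The constant system and a general surjective system
are the two instances needed.

Continuity is immediate, since every component is a composite of continuous maps. Coassociativity is
an equality in a limit, so it suffices to compare `n`-th components. The only difficulty is that `Δ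
⊗ id` is built for an arbitrary continuous ⋆-homomorphism of limits, by factoring each component
through some sufficiently high level. `proj_tensorMap_of_eq` shows that the outcome does not depend
on the factorisation. A levelwise `D` factors through level `n` itself, so the `n`-th component of
`Δ ⊗ id` is `Δ n ⊗ id`, and the claim becomes coassociativity of `Δ n`.

Density rests on two facts. First, a basic neighbourhood in the limit constrains finitely many
coordinates, and all of these are continuous functions of the highest one. A set is therefore dense
as soon as its image in every level is dense (`dense_of_dense_proj`). Second, for a sequence of
surjective connecting maps the projections of the limit are surjective. Every generator `Δ n c * (d
⊗ 1)` or `Δ n c * (1 ⊗ d)` at level `n` thus lifts to a generator over `A`, and the image of the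
span contains the dense span given by the compact quantum group at that level. -/

/-- The map is the composite of the connecting maps from level `n` down to level `i`, which are
continuous because ⋆-homomorphisms of C⋆-algebras are contractive. It lets a condition on a low
coordinate be restated on a higher one. -/
theorem exists_continuous_factor_proj (S : CStarSystem.{u}) {i n : ℕ} (h : i ≤ n) :
    ∃ g : S.obj n → S.obj i, Continuous g ∧ ∀ x : S.Lim, g (S.proj n x) = S.proj i x := by
  induction n, h using Nat.le_induction with
  | base => exact ⟨id, continuous_id, fun _ => rfl⟩
  | succ n _ ih =>
    obtain ⟨g, hg, hgx⟩ := ih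
    refine ⟨g ∘ S.map n, hg.comp (MinTensor.hom_continuous (S.map n)), fun x => ?_⟩
    rw [Function.comp_apply, S.map_proj, hgx]

/-- A subset of an inverse limit whose projections to all levels are dense is dense. -/
theorem dense_of_dense_proj {S : CStarSystem.{u}} {W : Set S.Lim}
    (h : ∀ n, Dense (S.proj n '' W)) : Dense W := by
  intro x
  rw [mem_closure_iff_nhds]
  intro U hU
  obtain ⟨V, hV, hVU⟩ := mem_nhds_induced _ _ _ |>.mp hU
  rw [nhds_pi, Filter.mem_pi] at hV
  obtain ⟨I, hI, t, ht, htV⟩ := hV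
  -- The neighbourhood constrains only the finitely many coordinates in `I`. A level `n` above all
  -- of them controls them simultaneously.
  obtain ⟨n, hn⟩ := hI.bddAbove
  -- The constraints are transported to level `n`. Quantifying over all `y` lying above `a` avoids
  -- naming a transition map for each `i`; points outside the image of the projection satisfy the
  -- condition vacuously.
  have hN : {a : S.obj n | ∀ i ∈ I, ∀ y : S.Lim, S.proj n y = a → S.proj i y ∈ t i} ∈
      nhds (S.proj n x) := by
    simp only [Set.ofPred_forall]
    refine (Filter.biInter_mem hI).mpr fun i hi => ?_
    simp only [← Set.ofPred_forall]
    -- The preimage of `t i` under the transition map to level `i` is a neighbourhood of the `n`-th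
    -- coordinate of `x`, and it forces the constraint at `i` for every `y` above it.
    obtain ⟨g, hg, hgx⟩ := S.exists_continuous_factor_proj (hn hi)
    have hgt : g ⁻¹' t i ∈ nhds (S.proj n x) :=
      hg.continuousAt.preimage_mem_nhds (by rw [hgx]; exact ht i)
    refine Filter.mem_of_superset hgt fun a ha y hy => ?_
    rw [← hgx, hy]
    exact ha
  -- Density at level `n` supplies a point of `W` whose `n`-th coordinate lies in this
  -- neighbourhood. Taking `y = w` in its definition puts `w` itself in `U`.
  obtain ⟨_, hw, w, hwW, rfl⟩ := mem_closure_iff_nhds.mp (h n (S.proj n x)) _ hN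
  exact ⟨w, hVU (htV fun i hi => hw i hi w rfl), hwW⟩

/-- Any factorisation of a component of `φ` through a level is its level map. -/
theorem levelMap_eq {S S' : CStarSystem.{u}} (hS : S.IsSurjective) {φ : S.Lim →⋆ₐ[ℂ] S'.Lim}
    {n m : ℕ} (h : Factors φ n m) {f : S.obj m →⋆ₐ[ℂ] S'.obj n}
    (hf : ∀ x, S'.proj n (φ x) = f (S.proj m x)) : levelMap hS φ h = f :=
  hom_ext_proj hS fun x => by rw [levelMap_proj, hf]

/-- `tensorMap` is built from a chosen level and from level maps defined by chosen preimages. Since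
the projections are surjective, a level map is determined by the homomorphism it factors, and the
level used does not affect the result. Any explicit pair `f`, `g` at a common level `m` may
therefore replace the choices, which makes the tensor product computable. -/
theorem proj_tensorMap_of_eq {S T S' T' : CStarSystem.{u}} (hS : S.IsSurjective)
    (hT : T.IsSurjective) {φ : S.Lim →⋆ₐ[ℂ] S'.Lim} {ψ : T.Lim →⋆ₐ[ℂ] T'.Lim}
    (hφ : Continuous φ) (hψ : Continuous ψ) {n m : ℕ} {f : S.obj m →⋆ₐ[ℂ] S'.obj n}
    {g : T.obj m →⋆ₐ[ℂ] T'.obj n} (hf : ∀ x, S'.proj n (φ x) = f (S.proj m x))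
    (hg : ∀ x, T'.proj n (ψ x) = g (T.proj m x)) (t : (S.tensor T).Lim) :
    (S'.tensor T').proj n (tensorMap hS hT φ ψ hφ hψ t) =
      MinTensor.map f g ((S.tensor T).proj m t) := by
  -- An explicit factorisation through level `m` kills whatever the projection to level `m` kills.
  have h₁ : Factors φ n m := fun x hx => by rw [hf, hx, map_zero]
  have h₂ : Factors ψ n m := fun x hx => by rw [hg, hx, map_zero]
  rw [proj_tensorMap hS hT φ ψ hφ hψ h₁ h₂, levelMap_eq hS h₁ hf, levelMap_eq hT h₂ hg]

end CStarSystem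

/-! ### From compact quantum groups at each level to the limit -/

open CStarSystem

/-- A comultiplication which is given levelwise by compact quantum groups is a
σ-C⋆-quantum group. -/
theorem IsSigmaCStarQuantumGroup.of_levels {A : Type u} [Ring A] [StarRing A] [Algebra ℂ A]
    [TopologicalSpace A] (P : SigmaCStarPresentation A) (D : A →⋆ₐ[ℂ] P.Square)
    (Δ : ∀ n, P.sys.obj n →⋆ₐ[ℂ] MinTensor (P.sys.obj n) (P.sys.obj n))
    (hD : ∀ n a, (P.sys.tensor P.sys).proj n (D a) = Δ n (P.sys.proj n (P.equiv a)))
    (hΔ : ∀ n, IsCompactQuantumGroup (Δ n)) : IsSigmaCStarQuantumGroup P D := by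
  have hc : Continuous D := by
    refine Continuous.subtype_mk (f := fun a n => (P.sys.tensor P.sys).proj n (D a))
      (continuous_pi fun n => ?_) fun a => (D a).2
    simp only [hD]
    exact (MinTensor.hom_continuous (Δ n)).comp
      ((P.sys.continuous_proj n).comp P.continuous_equiv)
  -- The tensor maps act on the presenting limit rather than on `A`, so the levelwise description of
  -- `D` is carried across the isomorphism `P.equiv`.
  have hD' : ∀ n x, (P.sys.tensor P.sys).proj n (P.toLim D x) = Δ n (P.sys.proj n x) :=
    fun n x => (hD n _).trans
      (congrArg (fun y => Δ n (P.sys.proj n y)) (P.equiv.apply_symm_apply x))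
  -- Surjectivity of the connecting maps enters here: elements of `A` reach every element of every
  -- level, so generators at a level can be lifted.
  have hsurj : ∀ n (c : P.sys.obj n), ∃ a, P.sys.proj n (P.equiv a) = c := fun n c => by
    obtain ⟨x, rfl⟩ := proj_surjective P.surjective n c
    exact ⟨P.equiv.symm x, congrArg _ (P.equiv.apply_symm_apply x)⟩
  have hone : ∀ n, P.sys.proj n (P.equiv 1) = 1 := fun n => by rw [map_one, map_one]
  refine ⟨hc, ?_, ?_, ?_⟩
  · refine StarAlgHom.ext fun a => lim_ext fun n => ?_
    -- Here `m = n`: both `D` and the identity have `n`-th components depending only on the `n`-th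
    -- coordinate, so no higher level is needed.
    have e₁ := proj_tensorMap_of_eq P.surjective P.surjective (P.continuous_toLim hc)
      continuous_id (hD' n) (g := StarAlgHom.id ℂ _)
      (ψ := StarAlgHom.id ℂ P.sys.Lim) (fun _ => rfl) (D a)
    have e₂ := proj_tensorMap_of_eq P.surjective P.surjective continuous_id
      (P.continuous_toLim hc) (f := StarAlgHom.id ℂ _)
      (φ := StarAlgHom.id ℂ P.sys.Lim) (fun _ => rfl) (hD' n) (D a)
    rw [hD] at e₁ e₂
    -- The identifications with the triple tensor product are also defined levelwise, so what
    -- remains is coassociativity of `Δ n` at the `n`-th coordinate of `a`.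
    exact (congrArg (MinTensor₃.assocLeft _ _ _) e₁).trans
      ((DFunLike.congr_fun (hΔ n).coassoc (P.sys.proj n (P.equiv a))).trans
        (congrArg (MinTensor₃.assocRight _ _ _) e₂).symm)
  -- Only one inclusion is needed: the projected span contains the span at level `n`, which is
  -- already dense.
  · refine dense_of_dense_proj fun n => (hΔ n).dense_left.mono ?_
    -- Viewing the projection as a linear map allows the image of the span to be rewritten as the
    -- span of the image, which reduces the inclusion to generators.
    change _ ⊆ (((P.sys.tensor P.sys).proj n).toAlgHom.toLinearMap '' _)
    rw [← Submodule.map_coe, SetLike.coe_subset_coe, Submodule.map_span]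
    refine Submodule.span_mono ?_
    rintro _ ⟨c, d, rfl⟩
    obtain ⟨a, rfl⟩ := hsurj n c
    obtain ⟨b, rfl⟩ := hsurj n d
    refine ⟨_, ⟨a, b, rfl⟩, (map_mul ((P.sys.tensor P.sys).proj n) _ _).trans ?_⟩
    -- Once the unit of level `n` is written as the projection of the unit of `A`, the second factor
    -- is by definition the `n`-th component of an elementary tensor over `A`.
    rw [hD, ← hone n]
    rfl
  -- The same argument, with the unit in the first tensor factor.
  · refine dense_of_dense_proj fun n => (hΔ n).dense_right.mono ?_
    change _ ⊆ (((P.sys.tensor P.sys).proj n).toAlgHom.toLinearMap '' _)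
    rw [← Submodule.map_coe, SetLike.coe_subset_coe, Submodule.map_span]
    refine Submodule.span_mono ?_
    rintro _ ⟨c, d, rfl⟩
    obtain ⟨a, rfl⟩ := hsurj n c
    obtain ⟨b, rfl⟩ := hsurj n d
    refine ⟨_, ⟨a, b, rfl⟩, (map_mul ((P.sys.tensor P.sys).proj n) _ _).trans ?_⟩
    rw [hD, ← hone n]
    rfl

end SigmaCStar

/-! ### The constant system and the general inverse limit -/

theorem mainTheorem2 :
    (∀ (A : Type u) [CStarAlgebra A] (Δ : A →⋆ₐ[ℂ] SigmaCStar.MinTensor A A),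
      SigmaCStar.IsCompactQuantumGroup Δ →
        SigmaCStar.IsSigmaCStarQuantumGroup
          (SigmaCStar.SigmaCStarPresentation.ofCStarAlgebra A) (SigmaCStar.constComul Δ)) ∧
    (∀ (S : SigmaCStar.CStarSystem.{u}) (hS : S.IsSurjective)
      (Δ : ∀ n, S.obj n →⋆ₐ[ℂ] SigmaCStar.MinTensor (S.obj n) (S.obj n))
      (hΔ : ∀ n, (SigmaCStar.MinTensor.map (S.map n) (S.map n)).comp (Δ (n + 1)) =
        (Δ n).comp (S.map n)),
      (∀ n, SigmaCStar.IsCompactQuantumGroup (Δ n)) →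
        SigmaCStar.IsSigmaCStarQuantumGroup
          (SigmaCStar.SigmaCStarPresentation.ofSystem S hS)
          (SigmaCStar.CStarSystem.Hom.lim (T := S.tensor S) ⟨Δ, hΔ⟩)) := by
  refine ⟨fun A _ Δ h => ?_, fun S hS Δ hΔ h => ?_⟩
  -- The isomorphism with the constant limit sends `a` to the constant sequence `a`, and every
  -- component of `constComul Δ` is `Δ`; the levelwise description is thus definitional.
  · exact .of_levels _ _ (fun _ => Δ) (fun _ _ => rfl) fun _ => h
  -- The presentation is tautological and the limit of a morphism of systems acts coordinatewise.
  -- Compatibility of the `Δ n` with the connecting maps has already been spent in forming that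
  -- morphism.
  · exact .of_levels _ _ Δ (fun _ _ => rfl) h
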